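/- Let $\mathcal V$ be any variety of algebras, i.e. the class of all algebras of a fixed signature satisfying a fixed set of identities. The variety $\mathcal V$ is congruence distributive (resp. congruence modular) if every algebra in $\mathcal V$ has a distributive (resp. modular) congruence lattice, and it has $m$-permuting congruences if $\alpha\circ\beta\circ\alpha\circ\cdots=\beta\circ\alpha\circ\beta\circ\cdots$ ($m$ factors on each side) for all congruences $\alpha,\beta$ of every algebra in $\mathcal V$. Consider the following systems of equations, to be satisfied identically in $\mathcal V$ by ternary terms. - $\mathrm{J}(n)$, for terms $J_0,\dots,J_{2n+1}$: $J_1(x,x,y)=x$; $J_{2n+1}(x,y,y)=y$; $J_i(x,y,x)=x$ for $0\le i\le 2n+1$; $J_{2i+1}(x,y,y)=J_{2i+2}(x,y,y)$ for $0\le i\le n-1$; $J_{2i}(x,x,y)=J_{2i+1}(x,x,y)$ for $1\le i\le n$. (The term $J_0$ is inessential.) - $\mathrm{DJ}(n)$, for terms $D_1,\dots,D_n$: $D_1(x,x,y)=x$; $D_n(x,y,y)=y$; $D_i(x,y,x)=x$ for $1\le i\le n$; $D_i(x,y,y)=D_{i+1}(x,x,y)$ for $1\le i<n$. - $\mathrm{G}(n)$,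 for terms $J_0,\dots,J_{2n+1}$ and $P$: the equations $\mathrm J(n)$ with $J_{2n+1}(x,y,y)=y$ replaced by $J_{2n+1}(x,y,y)=P(x,y,y)$ and $P(x,x,y)=y$. - $\mathrm{DG}(n)$, for terms $D_1,\dots,D_n$ and $Q$: the equations $\mathrm{DJ}(n)$ with $D_n(x,y,y)=y$ replaced by $D_n(x,y,y)=Q(x,y,y)$ and $Q(x,x,y)=y$. - $\mathrm{P}(n)$, for terms $P_1,\dots,P_n$: $P_1(x,y,y)=x$; $P_n(x,x,y)=y$; $P_i(x,y,x)=x$ for $1\le i\le n$; $P_i(x,x,y)=P_{i+1}(x,y,y)$ for $1\le i<n$. Then: 1. $\mathcal V$ is congruence distributive if and only if, for some $n\ge 1$, it has terms satisfying $\mathrm{DJ}(n)$ (directed Jónsson terms). In such a case there are, for some $n\ge 1$, terms $J_0,\dots,J_{2n+1}$ that satisfy $\mathrm J(n)$ and, at the same time, such that $J_1,\dots,J_{2n+1}$ satisfy $\mathrm{DJ}(2n+1)$. 2. For every integer $k\ge 1$, $\mathcal V$ is congruence distributive and has $(k+1)$-permuting congruences if and only if it has terms $P_1,\dots,P_k$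 satisfying $\mathrm P(k)$ (Pixley terms). 3. $\mathcal V$ is congruence modular if and only if, for some $n\ge 1$, it has terms satisfying $\mathrm{DG}(n)$ (directed Gumm terms). In such a case there are, for some $n\ge 1$, terms $J_0,\dots,J_{2n+1}$ and $P$ that satisfy $\mathrm G(n)$ and, at the same time, such that $J_1,\dots,J_{2n+1}$ and $P$ satisfy $\mathrm{DG}(2n+1)$. -/

import Mathlib

universe u v w

namespace UnivAlg

/-! ### Congruences of an algebra

A signature is a `FirstOrder.Language` without relation symbols, an algebra is a structure for it. -/

/-- A congruence of the algebra `A`: an equivalence relation compatible with all basic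
operations. -/
structure Congruence (L : FirstOrder.Language.{u, v}) (A : Type w) [L.Structure A] extends Setoid A where
  map_fun : ∀ {n : ℕ} (f : L.Functions n) (x y : Fin n → A),
    (∀ i, r (x i) (y i)) → r (FirstOrder.Language.Structure.funMap f x) (FirstOrder.Language.Structure.funMap f y)

namespace Congruence

variable {L : FirstOrder.Language.{u, v}} {A : Type w} [L.Structure A]

theorem toSetoid_injective :
    Function.Injective (toSetoid : Congruence L A → Setoid A) := by
  rintro ⟨r, hr⟩ ⟨s, hs⟩ h
  cases h
  rfl

/-- Congruences are ordered by inclusion. -/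
instance : PartialOrder (Congruence L A) :=
  PartialOrder.lift toSetoid toSetoid_injective

theorem le_def {α β : Congruence L A} : α ≤ β ↔ ∀ x y : A, α.r x y → β.r x y :=
  ⟨fun h _ _ hxy => h hxy, fun h _ _ hxy => h _ _ hxy⟩

/-- The infimum of a set of congruences is the intersection. -/
instance : InfSet (Congruence L A) where
  sInf S :=
    { r := fun x y => ∀ α ∈ S, α.r x y
      iseqv :=
        ⟨fun x α _ => α.iseqv.refl x,
          fun h α hα => α.iseqv.symm (h α hα),
          fun h₁ h₂ α hα => α.iseqv.trans (h₁ α hα) (h₂ α hα)⟩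
      map_fun := fun f x y h α hα => α.map_fun f x y fun i => h i α hα }

/-- The binary meet of congruences is the intersection. -/
instance : Min (Congruence L A) where
  min α β :=
    { r := fun x y => α.r x y ∧ β.r x y
      iseqv :=
        ⟨fun x => ⟨α.iseqv.refl x, β.iseqv.refl x⟩,
          fun h => ⟨α.iseqv.symm h.1, β.iseqv.symm h.2⟩,
          fun h₁ h₂ => ⟨α.iseqv.trans h₁.1 h₂.1, β.iseqv.trans h₁.2 h₂.2⟩⟩
      map_fun := fun f x y h =>
        ⟨α.map_fun f x y fun i => (h i).1, β.map_fun f x y fun i => (h i).2⟩ }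

/-- The congruence lattice of `A`. The join of two congruences is the least congruence that
contains both. -/
instance : CompleteLattice (Congruence L A) where
  __ := completeLatticeOfInf (Congruence L A) fun S =>
    ⟨fun _ hα => le_def.2 fun x y h => (show ∀ β ∈ S, β.r x y from h) _ hα,
      fun _ hβ => le_def.2 fun x y h _ hα => le_def.1 (hβ hα) x y h⟩
  inf := (· ⊓ ·)
  inf_le_left _ _ := le_def.2 fun _ _ h => h.1
  inf_le_right _ _ := le_def.2 fun _ _ h => h.2
  le_inf _ _ _ h₁ h₂ := le_def.2 fun x y h => ⟨le_def.1 h₁ x y h, le_def.1 h₂ x y h⟩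

end Congruence

/-- The relational product `r ∘ s ∘ r ∘ ⋯` of `m` alternating factors, the first one being `r`. -/
def altComp {A : Type w} : ℕ → (A → A → Prop) → (A → A → Prop) → A → A → Prop
  | 0, _, _ => Eq
  | m + 1, r, s => Relation.Comp r (altComp m s r)

/-! ### Varieties -/

/-- A variety of algebras of signature `L`, given by a set of identities between terms in countably
many variables. -/
structure Variety (L : FirstOrder.Language.{u, v}) where
  identities : Set (L.Term ℕ × L.Term ℕ)

namespace Variety

variable {L : FirstOrder.Language.{u, v}}

/-- `V.Mem A`: the algebra `A` belongs to the variety `V`, that is, it satisfies the identities of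
`V` under every assignment of the variables. -/
def Mem (V : Variety L) (A : Type w) [L.Structure A] : Prop :=
  ∀ e ∈ V.identities, ∀ a : ℕ → A, e.1.realize a = e.2.realize a

/-- Every algebra in `V` has a distributive congruence lattice. -/
def CongruenceDistributive (V : Variety L) : Prop :=
  ∀ (A : Type u) [L.Structure A] [Nonempty A], V.Mem A →
    ∀ α β γ : Congruence L A, α ⊓ (β ⊔ γ) = (α ⊓ β) ⊔ (α ⊓ γ)

/-- Every algebra in `V` has a modular congruence lattice. -/
def CongruenceModular (V : Variety L) : Prop :=
  ∀ (A : Type u) [L.Structure A] [Nonempty A], V.Mem A → IsModularLattice (Congruence L A)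

/-- `V` has `m`-permuting congruences: `α ∘ β ∘ α ∘ ⋯ = β ∘ α ∘ β ∘ ⋯` (with `m` factors on each
side) for all congruences `α`, `β` of every algebra in `V`. -/
def CongruencePermutable (V : Variety L) (m : ℕ) : Prop :=
  ∀ (A : Type u) [L.Structure A] [Nonempty A], V.Mem A →
    ∀ α β : Congruence L A, altComp m α.r β.r = altComp m β.r α.r

end Variety

/-! ### The systems of equations

They are stated for ternary operations `t i` on a set `A`; only the indices that occur in the
equations matter. -/

/-- The equations `J(n)` for `t 0, …, t (2 * n + 1)`. -/
structure IsJonsson {A : Type w} (n : ℕ) (t : ℕ → A → A → A → A) : Prop where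
  first : ∀ x y, t 1 x x y = x
  last : ∀ x y, t (2 * n + 1) x y y = y
  middle : ∀ i ≤ 2 * n + 1, ∀ x y, t i x y x = x
  odd : ∀ i < n, ∀ x y, t (2 * i + 1) x y y = t (2 * i + 2) x y y
  even : ∀ i, 1 ≤ i → i ≤ n → ∀ x y, t (2 * i) x x y = t (2 * i + 1) x x y

/-- The equations `DJ(n)` for `t 1, …, t n`. -/
structure IsDirectedJonsson {A : Type w} (n : ℕ) (t : ℕ → A → A → A → A) : Prop where
  first : ∀ x y, t 1 x x y = x
  last : ∀ x y, t n x y y = y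
  middle : ∀ i, 1 ≤ i → i ≤ n → ∀ x y, t i x y x = x
  step : ∀ i, 1 ≤ i → i < n → ∀ x y, t i x y y = t (i + 1) x x y

/-- The equations `G(n)` for `t 0, …, t (2 * n + 1)` and `p`. -/
structure IsGumm {A : Type w} (n : ℕ) (t : ℕ → A → A → A → A) (p : A → A → A → A) : Prop where
  first : ∀ x y, t 1 x x y = x
  last : ∀ x y, t (2 * n + 1) x y y = p x y y
  maltsev : ∀ x y, p x x y = y
  middle : ∀ i ≤ 2 * n + 1, ∀ x y, t i x y x = x
  odd : ∀ i < n, ∀ x y, t (2 * i + 1) x y y = t (2 * i + 2) x y y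
  even : ∀ i, 1 ≤ i → i ≤ n → ∀ x y, t (2 * i) x x y = t (2 * i + 1) x x y

/-- The equations `DG(n)` for `t 1, …, t n` and `q`. -/
structure IsDirectedGumm {A : Type w} (n : ℕ) (t : ℕ → A → A → A → A) (q : A → A → A → A) :
    Prop where
  first : ∀ x y, t 1 x x y = x
  last : ∀ x y, t n x y y = q x y y
  maltsev : ∀ x y, q x x y = y
  middle : ∀ i, 1 ≤ i → i ≤ n → ∀ x y, t i x y x = x
  step : ∀ i, 1 ≤ i → i < n → ∀ x y, t i x y y = t (i + 1) x x y

/-- The equations `P(n)` for `t 1, …, t n`. -/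
structure IsPixley {A : Type w} (n : ℕ) (t : ℕ → A → A → A → A) : Prop where
  first : ∀ x y, t 1 x y y = x
  last : ∀ x y, t n x x y = y
  middle : ∀ i, 1 ≤ i → i ≤ n → ∀ x y, t i x y x = x
  step : ∀ i, 1 ≤ i → i < n → ∀ x y, t i x x y = t (i + 1) x y y

/-! ### Terms satisfying the equations over a variety -/

/-- The ternary term operation on `A` of a term in three variables. -/
def termOp {L : FirstOrder.Language.{u, v}} (A : Type w) [L.Structure A] (t : L.Term (Fin 3)) (x y z : A) :
    A :=
  t.realize ![x, y, z]

namespace Variety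

variable {L : FirstOrder.Language.{u, v}}

/-- The terms `t` satisfy `J(n)` over `V`. -/
def Jonsson (V : Variety L) (n : ℕ) (t : ℕ → L.Term (Fin 3)) : Prop :=
  ∀ (A : Type u) [L.Structure A] [Nonempty A], V.Mem A →
    IsJonsson n fun i => termOp A (t i)

/-- The terms `t` satisfy `DJ(n)` over `V`. -/
def DirectedJonsson (V : Variety L) (n : ℕ) (t : ℕ → L.Term (Fin 3)) : Prop :=
  ∀ (A : Type u) [L.Structure A] [Nonempty A], V.Mem A →
    IsDirectedJonsson n fun i => termOp A (t i)

/-- The terms `t`, `p` satisfy `G(n)` over `V`. -/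
def Gumm (V : Variety L) (n : ℕ) (t : ℕ → L.Term (Fin 3)) (p : L.Term (Fin 3)) : Prop :=
  ∀ (A : Type u) [L.Structure A] [Nonempty A], V.Mem A →
    IsGumm n (fun i => termOp A (t i)) (termOp A p)

/-- The terms `t`, `q` satisfy `DG(n)` over `V`. -/
def DirectedGumm (V : Variety L) (n : ℕ) (t : ℕ → L.Term (Fin 3)) (q : L.Term (Fin 3)) : Prop :=
  ∀ (A : Type u) [L.Structure A] [Nonempty A], V.Mem A →
    IsDirectedGumm n (fun i => termOp A (t i)) (termOp A q)

/-- The terms `t` satisfy `P(n)` over `V`. -/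
def Pixley (V : Variety L) (n : ℕ) (t : ℕ → L.Term (Fin 3)) : Prop :=
  ∀ (A : Type u) [L.Structure A] [Nonempty A], V.Mem A →
    IsPixley n fun i => termOp A (t i)

end Variety

end UnivAlg

/-! A ternary term `t` with `t(x,y,x) = x` is read as an edge from `t(x,x,z)` to `t(x,z,z)` between
idempotent binary terms, which live in the free algebra on `x` and `z`. Directed Jónsson terms are a
directed path from `x` to `z`; Jónsson terms are a fence, a path that may also use edges backwards;
`k` Pixley terms are a path of `k` edges, all used backwards. For Gumm terms the path ends at some
`q(x,z,z)` with `q(x,x,z) = z`.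

Congruence conditions give fences. Distributivity joins `x` to `z` by Jónsson's argument in the free
algebra on three generators (`eqvGen_x_z`). Modularity gives Day terms, and an induction along them
produces `q` and a fence from `x` to `q(x,z,z)` (`exists_halfMaltsev`).

The core is the straightening of fences (`Climbs.step`). For a binary term `s`, consider the claim
that `x` lies below an iterated product `s(f₁, s(f₂, … z))`, where "below" is reachability by edges.
It is trivial when `s` is the first projection, and it can be carried across an edge in either
direction, at the price of a longer product. When `s` is the second projection the product is `z`,
so there is a directed path from `x` to `z`. When `s = q(x,z,z)` the product is again `t(x,z,z)` for
some `t` with `t(x,x,z) = z`, which gives directed Gumm terms.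

With permuting congruences, Hagemann–Mitschke terms act on the edge relation: they reverse edges and
shorten paths to length `k` (`chain_of_eqvGen`).

For the converses, if `a` and `b` are congruent modulo `α` and `t(x,y,x) = x`, then all elements
`t(a,c,b)` lie in the `α`-class of `a`. A move of `c` along `β` or `γ` is thus a move of `t(a,c,b)`
along `α ⊓ β` or `α ⊓ γ`. -/

namespace UnivAlg

open FirstOrder Language

/-! ### Term operations and substitution -/

section Terms

variable {L : FirstOrder.Language.{u, v}} {A : Type w} [L.Structure A]

theorem Congruence.realize (α : Congruence L A) {ι : Type*} (t : L.Term ι) {v w : ι → A}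
    (h : ∀ i, α.r (v i) (w i)) : α.r (t.realize v) (t.realize w) := by
  induction t with
  | var i => exact h i
  | func f ts ih => exact α.map_fun f _ _ ih

/-- The quaternary term operation on `A` of a term in four variables. -/
def termOp₄ (A : Type w) [L.Structure A] (t : L.Term (Fin 4)) (x y z u : A) : A :=
  t.realize ![x, y, z, u]

theorem Congruence.termOp (α : Congruence L A) (t : L.Term (Fin 3)) {x x' y y' z z' : A}
    (hx : α.r x x') (hy : α.r y y') (hz : α.r z z') :
    α.r (UnivAlg.termOp A t x y z) (UnivAlg.termOp A t x' y' z') :=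
  α.realize t fun i => by fin_cases i <;> assumption

/-- The projections, as terms. -/
def X₁ : L.Term (Fin 3) := Term.var 0
def X₂ : L.Term (Fin 3) := Term.var 1
def X₃ : L.Term (Fin 3) := Term.var 2

/-- Substitution of ternary terms into a ternary term. -/
def comp (t a b c : L.Term (Fin 3)) : L.Term (Fin 3) := t.subst ![a, b, c]

/-- Substitution of ternary terms into a quaternary term. -/
def comp₄ (t : L.Term (Fin 4)) (a b c d : L.Term (Fin 3)) : L.Term (Fin 3) :=
  t.subst ![a, b, c, d]

@[simp] theorem termOp_X₁ (x y z : A) : termOp A (X₁ : L.Term (Fin 3)) x y z = x := rfl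
@[simp] theorem termOp_X₂ (x y z : A) : termOp A (X₂ : L.Term (Fin 3)) x y z = y := rfl
@[simp] theorem termOp_X₃ (x y z : A) : termOp A (X₃ : L.Term (Fin 3)) x y z = z := rfl

@[simp] theorem termOp_comp (t a b c : L.Term (Fin 3)) (x y z : A) :
    termOp A (comp t a b c) x y z =
      termOp A t (termOp A a x y z) (termOp A b x y z) (termOp A c x y z) := by
  simp only [termOp, comp, Term.realize_subst]
  congr 1
  funext i
  fin_cases i <;> rfl

@[simp] theorem termOp_comp₄ (t : L.Term (Fin 4)) (a b c d : L.Term (Fin 3)) (x y z : A) :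
    termOp A (comp₄ t a b c d) x y z = termOp₄ A t (termOp A a x y z) (termOp A b x y z)
      (termOp A c x y z) (termOp A d x y z) := by
  simp only [termOp, termOp₄, comp₄, Term.realize_subst]
  congr 1
  funext i
  fin_cases i <;> rfl

end Terms

/-! ### Free algebras of a variety -/

namespace Variety

variable {L : FirstOrder.Language.{u, v}}

/-- Two terms are identified if they have the same value in every algebra of `V`. -/
def termSetoid (V : Variety L) (ι : Type) : Setoid (L.Term ι) where
  r s t := ∀ (A : Type u) [L.Structure A] [Nonempty A], V.Mem A →
    ∀ v : ι → A, s.realize v = t.realize v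
  iseqv :=
    ⟨fun _ _ _ _ _ _ => rfl, fun h A _ _ hA v => (h A hA v).symm,
      fun h₁ h₂ A _ _ hA v => (h₁ A hA v).trans (h₂ A hA v)⟩

/-- The free algebra of `V` over `ι`. -/
def Free (V : Variety L) (ι : Type) : Type u := Quotient (V.termSetoid ι)

namespace Free

variable {V : Variety L} {ι : Type}

/-- The element of the free algebra given by a term. -/
def mk (t : L.Term ι) : V.Free ι := Quotient.mk (V.termSetoid ι) t

/-- The free generators. -/
def gen (i : ι) : V.Free ι := mk (Term.var i)

theorem mk_surjective : Function.Surjective (mk : L.Term ι → V.Free ι) := Quotient.exists_rep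

theorem mk_eq_mk {s t : L.Term ι} : (mk s : V.Free ι) = mk t ↔
    ∀ (A : Type u) [L.Structure A] [Nonempty A], V.Mem A →
      ∀ v : ι → A, s.realize v = t.realize v :=
  ⟨fun h => Quotient.exact h, fun h => Quotient.sound h⟩

section Lift

variable {A : Type u} [L.Structure A] [Nonempty A]

/-- The homomorphism from the free algebra to `A` that extends `v`. -/
def lift (hA : V.Mem A) (v : ι → A) (p : V.Free ι) : A :=
  Quotient.lift (s := V.termSetoid ι) (fun t => t.realize v) (fun _ _ h => h A hA v) p

theorem lift_mk (hA : V.Mem A) (v : ι → A) (t : L.Term ι) : lift hA v (mk t) = t.realize v := rfl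

@[simp] theorem lift_gen (hA : V.Mem A) (v : ι → A) (i : ι) : lift hA v (gen i) = v i := rfl

end Lift

variable [L.IsAlgebraic]

noncomputable instance : L.Structure (V.Free ι) where
  funMap f x := mk (Term.func f fun i => (x i).out)
  RelMap r _ := isEmptyElim r

instance [Nonempty ι] : Nonempty (V.Free ι) := ⟨gen (Classical.arbitrary ι)⟩

theorem realize_mk {κ : Type*} (t : L.Term κ) (s : κ → L.Term ι) :
    t.realize (fun k => (mk (s k) : V.Free ι)) = mk (t.subst s) := by
  induction t with
  | var k => rfl
  | func f ts ih =>
    simp only [Term.realize_func, ih, Term.subst]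
    refine mk_eq_mk.2 fun A _ _ hA v => ?_
    simp only [Term.realize_func]
    congr 1
    funext i
    exact mk_eq_mk.1 (Quotient.out_eq _) A hA v

theorem realize_gen (t : L.Term ι) : t.realize (gen : ι → V.Free ι) = mk t := by
  refine (realize_mk t Term.var).trans (mk_eq_mk.2 fun A _ _ _ v => ?_)
  simp

theorem mem (V : Variety L) (ι : Type) : V.Mem (V.Free ι) := by
  intro e he a
  choose s hs using fun i => mk_surjective (a i)
  obtain rfl : (fun i => mk (s i)) = a := funext hs
  rw [realize_mk, realize_mk]
  refine mk_eq_mk.2 fun A _ _ hA v => ?_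
  simp only [Term.realize_subst]
  exact hA e he _

variable {A : Type u} [L.Structure A] [Nonempty A]

theorem lift_realize (hA : V.Mem A) (v : ι → A) {κ : Type*} (t : L.Term κ) (p : κ → V.Free ι) :
    lift hA v (t.realize p) = t.realize fun k => lift hA v (p k) := by
  choose s hs using fun i => mk_surjective (p i)
  obtain rfl : (fun i => mk (s i)) = p := funext hs
  simp only [realize_mk, lift_mk, Term.realize_subst]

theorem lift_termOp (hA : V.Mem A) (v : ι → A) (t : L.Term (Fin 3)) (p q r : V.Free ι) :
    lift hA v (termOp _ t p q r) = termOp A t (lift hA v p) (lift hA v q) (lift hA v r) := by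
  rw [termOp, lift_realize, termOp]
  congr 1
  funext i
  fin_cases i <;> rfl

theorem lift_termOp₄ (hA : V.Mem A) (v : ι → A) (t : L.Term (Fin 4)) (p q r s : V.Free ι) :
    lift hA v (termOp₄ _ t p q r s) =
      termOp₄ A t (lift hA v p) (lift hA v q) (lift hA v r) (lift hA v s) := by
  rw [termOp₄, lift_realize, termOp₄]
  congr 1
  funext i
  fin_cases i <;> rfl

/-- The kernel of the extension of `v` to the free algebra. -/
def ker (hA : V.Mem A) (v : ι → A) : Congruence L (V.Free ι) where
  r p q := lift hA v p = lift hA v q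
  iseqv := ⟨fun _ => rfl, fun h => h.symm, fun h₁ h₂ => h₁.trans h₂⟩
  map_fun {n} f x y h := by
    have := fun z : Fin n → V.Free ι => lift_realize hA v (Functions.term f) z
    simp only [Term.realize_function_term] at this
    rw [this, this]
    congr 1
    funext i
    exact h i

theorem ker_iff {hA : V.Mem A} {v : ι → A} {p q : V.Free ι} :
    (ker hA v).r p q ↔ lift hA v p = lift hA v q := Iff.rfl

theorem exists_termOp (p : V.Free (Fin 3)) :
    ∃ t : L.Term (Fin 3), termOp _ t (gen 0) (gen 1) (gen 2) = p := by
  obtain ⟨t, rfl⟩ := mk_surjective p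
  refine ⟨t, ?_⟩
  rw [← realize_gen, termOp]
  congr 1
  funext i
  fin_cases i <;> rfl

theorem exists_termOp₄ (p : V.Free (Fin 4)) :
    ∃ t : L.Term (Fin 4), termOp₄ _ t (gen 0) (gen 1) (gen 2) (gen 3) = p := by
  obtain ⟨t, rfl⟩ := mk_surjective p
  refine ⟨t, ?_⟩
  rw [← realize_gen, termOp₄]
  congr 1
  funext i
  fin_cases i <;> rfl

end Free

end Variety

/-! ### Joins of congruences -/

namespace Congruence

variable {L : FirstOrder.Language.{u, v}} {A : Type w} [L.Structure A]

/-- The relations `β`, `β ∘ γ ∘ β`, `β ∘ γ ∘ β ∘ γ ∘ β ∘ γ ∘ β`, …, whose union is `β ⊔ γ`. -/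
def joinRel (β γ : Congruence L A) : ℕ → A → A → Prop
  | 0 => β.r
  | k + 1 => fun a b => ∃ c d, joinRel β γ k a c ∧ γ.r c d ∧ joinRel β γ k d b

variable {β γ : Congruence L A}

theorem joinRel_refl (k : ℕ) (a : A) : joinRel β γ k a a := by
  induction k with
  | zero => exact β.iseqv.refl a
  | succ k ih => exact ⟨a, a, ih, γ.iseqv.refl a, ih⟩

theorem joinRel_symm {k : ℕ} : ∀ {a b : A}, joinRel β γ k a b → joinRel β γ k b a := by
  induction k with
  | zero => exact fun h => β.iseqv.symm h
  | succ k ih => exact fun ⟨c, d, h₁, h₂, h₃⟩ => ⟨d, c, ih h₃, γ.iseqv.symm h₂, ih h₁⟩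

theorem joinRel_mono {a b : A} {k l : ℕ} (hkl : k ≤ l) (h : joinRel β γ k a b) :
    joinRel β γ l a b := by
  induction hkl with
  | refl => exact h
  | step _ ih => exact ⟨b, b, ih, γ.iseqv.refl b, joinRel_refl _ b⟩

theorem joinRel_funMap {n : ℕ} (f : L.Functions n) {k : ℕ} : ∀ {x y : Fin n → A},
    (∀ i, joinRel β γ k (x i) (y i)) →
      joinRel β γ k (Structure.funMap f x) (Structure.funMap f y) := by
  induction k with
  | zero => exact fun h => β.map_fun f _ _ h
  | succ k ih =>
    intro x y h
    choose c d h₁ h₂ h₃ using h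
    exact ⟨_, _, ih h₁, γ.map_fun f c d h₂, ih h₃⟩

theorem joinRel_realize {ι : Type*} (t : L.Term ι) {k : ℕ} {v w : ι → A}
    (h : ∀ i, joinRel β γ k (v i) (w i)) : joinRel β γ k (t.realize v) (t.realize w) := by
  induction t with
  | var i => exact h i
  | func f ts ih => exact joinRel_funMap f ih

theorem joinRel_termOp (t : L.Term (Fin 3)) {k : ℕ} {x x' y y' z z' : A}
    (hx : joinRel β γ k x x') (hy : joinRel β γ k y y') (hz : joinRel β γ k z z') :
    joinRel β γ k (UnivAlg.termOp A t x y z) (UnivAlg.termOp A t x' y' z') :=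
  joinRel_realize t fun i => by fin_cases i <;> assumption

theorem exists_joinRel {a b : A} (h : (β ⊔ γ).r a b) : ∃ k, joinRel β γ k a b := by
  let δ : Congruence L A :=
    { r := fun a b => ∃ k, joinRel β γ k a b
      iseqv :=
        ⟨fun a => ⟨0, joinRel_refl 0 a⟩, fun ⟨k, hk⟩ => ⟨k, joinRel_symm hk⟩,
          fun {a b c} ⟨k, hk⟩ ⟨l, hl⟩ => ⟨max k l + 1, b, b,
            joinRel_mono (le_max_left _ _) hk, γ.iseqv.refl b,
            joinRel_mono (le_max_right _ _) hl⟩⟩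
      map_fun := fun {n} f x y h => by
        choose k hk using h
        exact ⟨Finset.univ.sup k, joinRel_funMap f fun i =>
          joinRel_mono (Finset.le_sup (Finset.mem_univ i)) (hk i)⟩ }
  have hβ : β ≤ δ := le_def.2 fun x y h => ⟨0, h⟩
  have hγ : γ ≤ δ := le_def.2 fun x y h =>
    ⟨1, x, y, β.iseqv.refl x, h, β.iseqv.refl y⟩
  exact le_def.1 (sup_le hβ hγ) a b h

theorem reflTransGen_of_sup {a b : A} (h : (β ⊔ γ).r a b) :
    Relation.ReflTransGen (fun x y => β.r x y ∨ γ.r x y) a b := by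
  obtain ⟨k, hk⟩ := exists_joinRel h
  clear h
  induction k generalizing a b with
  | zero => exact .single (Or.inl hk)
  | succ k ih =>
    obtain ⟨c, d, h₁, h₂, h₃⟩ := hk
    exact ((ih h₁).tail (Or.inr h₂)).trans (ih h₃)

theorem sup_of_left {a b : A} (h : β.r a b) : (β ⊔ γ).r a b := le_def.1 le_sup_left a b h

theorem sup_of_right {a b : A} (h : γ.r a b) : (β ⊔ γ).r a b := le_def.1 le_sup_right a b h

end Congruence

end UnivAlg

namespace UnivAlg

open Relation

/-! ### Straightening fences

`r` is a reflexive compatible relation, `le` a preorder below the preorder generated by `r`. -/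

section Fence

variable {A : Type w}

/-- A binary operation that is idempotent and preserves `r` and `le`. -/
structure PreservesBin (r le : A → A → Prop) (f : A → A → A) : Prop where
  idem : ∀ a, f a a = a
  rel : ∀ {a b c d}, r a b → r c d → r (f a c) (f b d)
  mono : ∀ {a b c d}, le a b → le c d → le (f a c) (f b d)

/-- A ternary operation that is idempotent, preserves `r`, and by which `le` absorbs the preorder
generated by `r`. -/
structure Absorbs (r le : A → A → Prop) (G : A → A → A → A) : Prop where
  idem : ∀ a, G a a a = a
  rel : ∀ {a a' b b' c c'}, r a a' → r b b' → r c c' → r (G a b c) (G a' b' c')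
  absorb : ∀ {a a' b b' c c'}, le a a' → ReflTransGen r b b' → le c c' →
    le (G a b c) (G a' b' c')

/-- The iterated product `s (f a u) (s (g a u) (⋯ u))` over the list of the operations `f, g, …`. -/
def nest (s : A → A → A) (a u : A) : List (A → A → A) → A
  | [] => u
  | f :: l => s (f a u) (nest s a u l)

/-- Below `u` one can climb from every `a` with `r a u` to a product of the form `nest s a u l`. -/
def Climbs (r le : A → A → Prop) (s : A → A → A) : Prop :=
  ∃ l : List (A → A → A), (∀ f ∈ l, PreservesBin r le f) ∧
    l.Pairwise (fun f g => ∀ a u, r a u → r (f a u) (g a u)) ∧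
    ∀ a u, r a u → le a (nest s a u l)

variable {r le : A → A → Prop}

theorem reflTransGen_map₂ (hr : ∀ a, r a a) {f : A → A → A}
    (hf : ∀ {a b c d}, r a b → r c d → r (f a c) (f b d)) {a b c d : A}
    (h₁ : ReflTransGen r a b) (h₂ : ReflTransGen r c d) : ReflTransGen r (f a c) (f b d) :=
  (h₁.lift (fun x => f x c) fun _ _ h => hf h (hr c)).trans
    (h₂.lift (fun x => f b x) fun _ _ h => hf (hr b) h)

theorem nest_preserves {s : A → A → A} (hs : PreservesBin r le s)
    {l : List (A → A → A)} (hl : ∀ f ∈ l, PreservesBin r le f) :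
    PreservesBin r le fun a u => nest s a u l := by
  induction l with
  | nil => exact ⟨fun _ => rfl, fun _ h => h, fun _ h => h⟩
  | cons f l ih =>
    obtain ⟨h1, h2⟩ := List.forall_mem_cons.1 hl
    have ih := ih h2
    refine ⟨fun a => ?_, fun h h' => ?_, fun h h' => ?_⟩
    · have := ih.idem a
      simp only [nest] at this ⊢
      rw [this, h1.idem, hs.idem]
    · exact hs.rel (h1.rel h h') (ih.rel h h')
    · exact hs.mono (h1.mono h h') (ih.mono h h')

/-- Idempotence writes `x` as the same product with all factors equal to `x`; compatibility then
compares factor by factor. -/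
theorem nest_above {R : A → A → Prop} {s : A → A → A} (hs : ∀ a, s a a = a)
    (hR : ∀ {a b c d}, R a b → R c d → R (s a c) (s b d)) {x a u : A}
    {l : List (A → A → A)} (hu : R x u) (hl : ∀ f ∈ l, R x (f a u)) : R x (nest s a u l) := by
  induction l with
  | nil => exact hu
  | cons f l ih =>
    obtain ⟨h1, h2⟩ := List.forall_mem_cons.1 hl
    have := hR h1 (ih h2)
    rwa [hs] at this

theorem Absorbs.right {G : A → A → A → A} (hG : Absorbs r le G)
    (hle : ∀ {a b}, le a b → ReflTransGen r a b) :
    PreservesBin r le fun x z => G x z z :=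
  ⟨fun a => hG.idem a, fun h h' => hG.rel h h' h', fun h h' => hG.absorb h (hle h') h'⟩

/-- The step back along `G` and forth along `H`. -/
theorem Climbs.step (hr : ∀ a, r a a) (hrefl : ∀ a, le a a)
    (htrans : ∀ {a b c}, le a b → le b c → le a c)
    (hle : ∀ {a b}, le a b → ReflTransGen r a b) {G H : A → A → A → A}
    (hG : Absorbs r le G) (hH : Absorbs r le H) (hGH : ∀ x z, G x x z = H x x z)
    (h : Climbs r le fun x z => G x z z) : Climbs r le fun x z => H x z z := by
  obtain ⟨l, hl, hpair, hclimb⟩ := h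
  have hs := hG.right hle
  have hs' := hH.right hle
  set s : A → A → A := fun x z => G x z z with hs_def
  set s' : A → A → A := fun x z => H x z z with hs'_def
  have hV : PreservesBin r le fun a u => nest s a u l := nest_preserves hs hl
  set V : A → A → A := fun a u => nest s a u l with hV_def
  have bounds : ∀ {f}, PreservesBin r le f → ∀ {a u}, r a u → r a (f a u) ∧ r (f a u) u := by
    intro f hf a u h
    have h1 := hf.rel (hr a) h
    have h2 := hf.rel h (hr u)
    rw [hf.idem] at h1 h2
    exact ⟨h1, h2⟩
  -- The second half of the list dominates the element `w l` below; the first half dominates the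
  -- product `nest s a (w l) l` built over it, each factor of which is raised to `V a u`.
  refine ⟨l.map (fun _ => V) ++ l.map fun f a u => f (V a u) u, ?_, ?_, ?_⟩
  · intro f hf
    rcases List.mem_append.1 hf with hf | hf
    · obtain ⟨g, -, rfl⟩ := List.mem_map.1 hf
      exact hV
    · obtain ⟨g, hg, rfl⟩ := List.mem_map.1 hf
      have hg := hl g hg
      exact ⟨fun a => by rw [hV.idem, hg.idem], fun h h' => hg.rel (hV.rel h h') h',
        fun h h' => hg.mono (hV.mono h h') h'⟩
  · refine List.pairwise_append.2 ⟨?_, ?_, ?_⟩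
    · exact List.pairwise_map.2 (List.pairwise_of_forall fun _ _ a u _ => hr _)
    · exact List.pairwise_map.2 (hpair.imp fun h a u hau => h _ _ (bounds hV hau).2)
    · intro f hf g hg a u hau
      obtain ⟨_, -, rfl⟩ := List.mem_map.1 hf
      obtain ⟨g, hgl, rfl⟩ := List.mem_map.1 hg
      exact (bounds (hl g hgl) (bounds hV hau).2).1
  · intro a u hau
    have hrE : ∀ {x y : A}, r x y → ReflTransGen r x y := fun h => .single h
    have E_s' : ∀ {a b c d}, ReflTransGen r a b → ReflTransGen r c d →
        ReflTransGen r (s' a c) (s' b d) := reflTransGen_map₂ hr hs'.rel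
    -- the products with the steps of `G` reversed
    let w : List (A → A → A) → A := fun l =>
      l.foldr (fun f x => G (f a u) (f a u) x) u
    let Y : (A → A → A) → A → A → A := fun f a u => f (V a u) u
    have haV : le a (V a u) := hclimb a u hau
    have hVu : r (V a u) u := (bounds hV hau).2
    -- The middle argument of `G` rises from `f a u` to the remaining product, to which it is
    -- `r`-related. This is the purpose of the pairwise condition on the list.
    have hw1 : ∀ m : List (A → A → A), (∀ f ∈ m, PreservesBin r le f) →
        m.Pairwise (fun f g => ∀ a u, r a u → r (f a u) (g a u)) → le (w m) (nest s a u m) := by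
      intro m
      induction m with
      | nil => exact fun _ _ => hrefl u
      | cons f m ih =>
        intro hm hp
        obtain ⟨h1, h2⟩ := List.forall_mem_cons.1 hm
        obtain ⟨p1, p2⟩ := List.pairwise_cons.1 hp
        refine hG.absorb (hrefl _) (hrE ?_) (ih h2 p2)
        exact nest_above hs.idem hs.rel (bounds h1 hau).2 fun g hg => p1 g hg a u hau
    -- As its first two arguments coincide, each `G` in `w m` may be read as `H`; its middle
    -- argument then rises to the remaining product for `H`.
    have hw2 : ∀ m : List (A → A → A), (∀ f ∈ m, PreservesBin r le f) →
        m.Pairwise (fun f g => ∀ a u, r a u → r (f a u) (g a u)) →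
        le (w m) (nest s' a u (m.map Y)) := by
      intro m
      induction m with
      | nil => exact fun _ _ => hrefl u
      | cons f m ih =>
        intro hm hp
        obtain ⟨h1, h2⟩ := List.forall_mem_cons.1 hm
        obtain ⟨p1, p2⟩ := List.pairwise_cons.1 hp
        have hY : ∀ g, PreservesBin r le g → le (g a u) (Y g a u) := fun g hg =>
          hg.mono haV (hrefl u)
        change le (G (f a u) (f a u) (w m)) (H (Y f a u) _ _)
        rw [hGH]
        refine hH.absorb (hY f h1) ?_ (ih h2 p2)
        refine nest_above (R := ReflTransGen r) hs'.idem E_s' (hrE (bounds h1 hau).2) ?_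
        intro g hg
        obtain ⟨g, hgl, rfl⟩ := List.mem_map.1 hg
        exact (hrE (p1 g hgl a u hau)).trans (hle (hY g (h2 g hgl)))
    have hw3 : ∀ m : List (A → A → A), (∀ f ∈ m, PreservesBin r le f) → r a (w m) := by
      intro m
      induction m with
      | nil => exact fun _ => hau
      | cons f m ih =>
        intro hm
        obtain ⟨h1, h2⟩ := List.forall_mem_cons.1 hm
        have := hG.rel (bounds h1 hau).1 (bounds h1 hau).1 (ih h2)
        rwa [hG.idem] at this
    have hwV : le (w l) (V a u) := hw1 l hl hpair
    have hVq : ∀ m : List (A → A → A), (∀ f ∈ m, PreservesBin r le f) →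
        ReflTransGen r (V a u) (nest s' a u (m.map (fun _ => V) ++ l.map Y)) := by
      intro m hm
      refine nest_above (R := ReflTransGen r) hs'.idem E_s' (hrE hVu) fun g hg => ?_
      rcases List.mem_append.1 hg with hg | hg
      · obtain ⟨_, -, rfl⟩ := List.mem_map.1 hg
        exact .refl
      · obtain ⟨g, hgl, rfl⟩ := List.mem_map.1 hg
        exact hrE (bounds (hl g hgl) hVu).1
    -- Every factor and every tail on the left lies below `V a u`, so each `G` factor is bounded by
    -- one of the form `G v v _ = H v v _`, whose middle argument then climbs along `H`.
    have key : ∀ m : List (A → A → A), (∀ f ∈ m, PreservesBin r le f) →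
        le (nest s a (w l) m) (nest s' a u (m.map (fun _ => V) ++ l.map Y)) := by
      intro m
      induction m with
      | nil => exact fun _ => hw2 l hl hpair
      | cons f m ih =>
        intro hm
        obtain ⟨h1, h2⟩ := List.forall_mem_cons.1 hm
        have hfV : le (f a (w l)) (V a u) := by
          have := h1.mono haV hwV
          rwa [h1.idem] at this
        have hnV : le (nest s a (w l) m) (V a u) := by
          have hn := nest_preserves hs h2
          have := hn.mono haV hwV
          rwa [hn.idem] at this
        refine htrans (b := G (V a u) (V a u) (nest s a (w l) m))
          (hG.absorb hfV (hle hnV) (hrefl _)) ?_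
        rw [hGH]
        exact hH.absorb (hrefl _) (hVq m h2) (ih h2)
    -- The given climb is used with `w l` in place of `u`, which is why `Climbs` is uniform in `u`.
    exact htrans (hclimb a (w l) (hw3 l hl)) (key l hl)

end Fence

end UnivAlg

namespace UnivAlg

open Relation FirstOrder Language

/-! ### Idempotent binary terms, edges between them, and directed paths -/

namespace Variety

variable {L : FirstOrder.Language.{u, v}} (V : Variety L)

/-- `t` is idempotent in `V`. -/
def IsIdempotent (t : L.Term (Fin 3)) : Prop :=
  ∀ (A : Type u) [L.Structure A] [Nonempty A], V.Mem A → ∀ a : A, termOp A t a a a = a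

/-- `t` satisfies `t(x, y, x) = x` in `V`. -/
def IsAbsorbing (t : L.Term (Fin 3)) : Prop :=
  ∀ (A : Type u) [L.Structure A] [Nonempty A], V.Mem A → ∀ a b : A, termOp A t a b a = a

/-- `t` is idempotent in `V`. -/
def IsIdempotent₄ (t : L.Term (Fin 4)) : Prop :=
  ∀ (A : Type u) [L.Structure A] [Nonempty A], V.Mem A → ∀ a : A, termOp₄ A t a a a a = a

variable {V} {s t a b c : L.Term (Fin 3)}

theorem IsAbsorbing.isIdempotent (h : V.IsAbsorbing t) : V.IsIdempotent t :=
  fun A _ _ hA a => h A hA a a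

theorem isAbsorbing_X₁ : V.IsAbsorbing X₁ := fun _ _ _ _ _ _ => rfl

theorem isAbsorbing_X₃ : V.IsAbsorbing X₃ := fun _ _ _ _ _ _ => rfl

theorem isIdempotent_X₂ : V.IsIdempotent X₂ := fun _ _ _ _ _ => rfl

theorem IsIdempotent.comp (ht : V.IsIdempotent t) (ha : V.IsIdempotent a)
    (hb : V.IsIdempotent b) (hc : V.IsIdempotent c) : V.IsIdempotent (comp t a b c) :=
  fun A _ _ hA x => by simp [ha A hA, hb A hA, hc A hA, ht A hA]

theorem IsIdempotent.comp_absorbing (ht : V.IsIdempotent t) (ha : V.IsAbsorbing a)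
    (hb : V.IsAbsorbing b) (hc : V.IsAbsorbing c) : V.IsAbsorbing (UnivAlg.comp t a b c) :=
  fun A _ _ hA x y => by simp [ha A hA, hb A hA, hc A hA, ht A hA]

theorem IsAbsorbing.comp (ht : V.IsAbsorbing t) (ha : V.IsAbsorbing a) (hc : V.IsAbsorbing c) :
    V.IsAbsorbing (comp t a b c) :=
  fun A _ _ hA x y => by simp [ha A hA, hc A hA, ht A hA]

theorem IsIdempotent₄.comp {t : L.Term (Fin 4)} (ht : V.IsIdempotent₄ t)
    {d : L.Term (Fin 3)} (ha : V.IsIdempotent a) (hb : V.IsIdempotent b) (hc : V.IsIdempotent c)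
    (hd : V.IsIdempotent d) : V.IsIdempotent (comp₄ t a b c d) :=
  fun A _ _ hA x => by simp [ha A hA, hb A hA, hc A hA, hd A hA, ht A hA]

theorem IsIdempotent₄.comp_absorbing {t : L.Term (Fin 4)} (ht : V.IsIdempotent₄ t)
    {d : L.Term (Fin 3)} (ha : V.IsAbsorbing a) (hb : V.IsAbsorbing b) (hc : V.IsAbsorbing c)
    (hd : V.IsAbsorbing d) : V.IsAbsorbing (comp₄ t a b c d) :=
  fun A _ _ hA x y => by simp [ha A hA, hb A hA, hc A hA, hd A hA, ht A hA]

variable [L.IsAlgebraic]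

local notation "𝓍" => (Free.gen 0 : V.Free (Fin 2))
local notation "𝓏" => (Free.gen 1 : V.Free (Fin 2))

variable (V) in
/-- The idempotent elements of the free algebra over two generators. -/
def Bin : Type u :=
  {p : V.Free (Fin 2) // ∃ t, V.IsIdempotent t ∧ termOp _ t 𝓍 𝓍 𝓏 = p}

namespace Bin

/-- Equalities between elements of the free algebra on two generators hold as identities throughout
`V`; in this way paths in `Bin` become equations for terms. -/
theorem lift_eq {A : Type u} [L.Structure A] [Nonempty A] (hA : V.Mem A) (a c : A)
    (h : termOp _ s 𝓍 𝓍 𝓏 = termOp _ t 𝓍 𝓍 𝓏) : termOp A s a a c = termOp A t a a c := by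
  simpa [Free.lift_termOp] using congrArg (Free.lift hA ![a, c]) h

theorem lift_eq' {A : Type u} [L.Structure A] [Nonempty A] (hA : V.Mem A) (a c : A)
    (h : termOp _ s 𝓍 𝓏 𝓏 = termOp _ t 𝓍 𝓍 𝓏) : termOp A s a c c = termOp A t a a c := by
  simpa [Free.lift_termOp] using congrArg (Free.lift hA ![a, c]) h

/-- The term operations on the idempotent elements. -/
noncomputable def op (t : L.Term (Fin 3)) (ht : V.IsIdempotent t) (p q s : V.Bin) : V.Bin :=
  ⟨termOp _ t p.1 q.1 s.1, by
    obtain ⟨_, a, ha, rfl⟩ := p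
    obtain ⟨_, b, hb, rfl⟩ := q
    obtain ⟨_, c, hc, rfl⟩ := s
    exact ⟨comp t a b c, ht.comp ha hb hc, by simp⟩⟩

/-- The quaternary term operations on the idempotent elements. -/
noncomputable def op₄ (t : L.Term (Fin 4)) (ht : V.IsIdempotent₄ t) (p q s e : V.Bin) : V.Bin :=
  ⟨termOp₄ _ t p.1 q.1 s.1 e.1, by
    obtain ⟨_, a, ha, rfl⟩ := p
    obtain ⟨_, b, hb, rfl⟩ := q
    obtain ⟨_, c, hc, rfl⟩ := s
    obtain ⟨_, d, hd, rfl⟩ := e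
    exact ⟨comp₄ t a b c d, ht.comp ha hb hc hd, by simp⟩⟩

/-- The first generator. -/
def x : V.Bin := ⟨𝓍, X₁, isAbsorbing_X₁.isIdempotent, rfl⟩

/-- The second generator. -/
def z : V.Bin := ⟨𝓏, X₃, isAbsorbing_X₃.isIdempotent, rfl⟩

/-- The relation `{(t(x, x, z), t(x, z, z))}`, where `t` ranges over the idempotent terms. -/
def Rel (p q : V.Bin) : Prop :=
  ∃ t, V.IsIdempotent t ∧ termOp _ t 𝓍 𝓍 𝓏 = p.1 ∧ termOp _ t 𝓍 𝓏 𝓏 = q.1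

/-- The relation `{(t(x, x, z), t(x, z, z))}`, where `t` ranges over the terms with
`t(x, y, x) = x`. -/
def Edge (p q : V.Bin) : Prop :=
  ∃ t, V.IsAbsorbing t ∧ termOp _ t 𝓍 𝓍 𝓏 = p.1 ∧ termOp _ t 𝓍 𝓏 𝓏 = q.1

theorem Edge.rel {p q : V.Bin} : Edge p q → Rel p q :=
  fun ⟨t, ht, h⟩ => ⟨t, ht.isIdempotent, h⟩

/-- This is why only idempotent elements are kept: `t(x,x,z)`, as a term not involving `y`,
satisfies the absorption identity exactly when `t` is idempotent. -/
theorem Edge.refl (p : V.Bin) : Edge p p := by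
  obtain ⟨_, t, ht, rfl⟩ := p
  exact ⟨comp t X₁ X₁ X₃, ht.comp_absorbing isAbsorbing_X₁ isAbsorbing_X₁ isAbsorbing_X₃,
    by simp, by simp⟩

theorem Rel.refl (p : V.Bin) : Rel p p := (Edge.refl p).rel

theorem rel_x_z : Rel (x : V.Bin) z := ⟨X₂, isIdempotent_X₂, rfl, rfl⟩

theorem Rel.op (ht : V.IsIdempotent t) {p p' q q' e e' : V.Bin} :
    Rel p p' → Rel q q' → Rel e e' → Rel (op t ht p q e) (Bin.op t ht p' q' e') := by
  rintro ⟨a, ha, ha1, ha2⟩ ⟨b, hb, hb1, hb2⟩ ⟨c, hc, hc1, hc2⟩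
  exact ⟨comp t a b c, ht.comp ha hb hc, by simp [*, Bin.op], by simp [*, Bin.op]⟩

theorem Edge.op (ht : V.IsIdempotent t) {p p' q q' e e' : V.Bin} :
    Edge p p' → Edge q q' → Edge e e' → Edge (op t ht p q e) (Bin.op t ht p' q' e') := by
  rintro ⟨a, ha, ha1, ha2⟩ ⟨b, hb, hb1, hb2⟩ ⟨c, hc, hc1, hc2⟩
  exact ⟨comp t a b c, ht.comp_absorbing ha hb hc, by simp [*, Bin.op], by simp [*, Bin.op]⟩

/-- Once the outer arguments agree, `t` ignores its middle argument, so the term inserted there need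
not be absorbing. -/
theorem Edge.op_absorbing (ht : V.IsAbsorbing t) {p p' q q' e e' : V.Bin} :
    Edge p p' → Rel q q' → Edge e e' →
      Edge (Bin.op t ht.isIdempotent p q e) (Bin.op t ht.isIdempotent p' q' e') := by
  rintro ⟨a, ha, ha1, ha2⟩ ⟨b, hb, hb1, hb2⟩ ⟨c, hc, hc1, hc2⟩
  exact ⟨comp t a b c, ht.comp ha hc, by simp [*, Bin.op], by simp [*, Bin.op]⟩

theorem Edge.op₄ {t : L.Term (Fin 4)} (ht : V.IsIdempotent₄ t) {p p' q q' e e' f f' : V.Bin} :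
    Edge p p' → Edge q q' → Edge e e' → Edge f f' →
      Edge (op₄ t ht p q e f) (Bin.op₄ t ht p' q' e' f') := by
  rintro ⟨a, ha, ha1, ha2⟩ ⟨b, hb, hb1, hb2⟩ ⟨c, hc, hc1, hc2⟩ ⟨d, hd, hd1, hd2⟩
  exact ⟨comp₄ t a b c d, ht.comp_absorbing ha hb hc hd, by simp [*, Bin.op₄],
    by simp [*, Bin.op₄]⟩

/-- The preorder generated by the edges. -/
abbrev Le : V.Bin → V.Bin → Prop := ReflTransGen Edge

theorem absorbs_op (ht : V.IsAbsorbing t) :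
    Absorbs Rel Le (op t ht.isIdempotent : V.Bin → V.Bin → V.Bin → V.Bin) where
  idem _ := Subtype.ext (ht _ (Free.mem V (Fin 2)) _ _)
  rel := Rel.op ht.isIdempotent
  absorb {_ p' q q' e _} h₁ h₂ h₃ :=
    ((h₁.lift (fun y => op t ht.isIdempotent y q e) fun _ _ h =>
      h.op_absorbing ht (Rel.refl _) (Edge.refl _)).trans
      (h₂.lift (fun y => op t ht.isIdempotent p' y e) fun _ _ h =>
        (Edge.refl _).op_absorbing ht h (Edge.refl _))).trans
      (h₃.lift (fun y => op t ht.isIdempotent p' q' y) fun _ _ h =>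
        (Edge.refl _).op_absorbing ht (Rel.refl _) h)

/-- The middle argument does not occur, so idempotence suffices. This operation lets the source
`t(x,x,z)` of an edge take the place of `G x z z` in `Climbs.step`. -/
theorem absorbs_op_left (ht : V.IsIdempotent t) :
    Absorbs Rel Le (fun p _ q => op t ht p p q : V.Bin → V.Bin → V.Bin → V.Bin) where
  idem _ := Subtype.ext (ht _ (Free.mem V (Fin 2)) _)
  rel h₁ _ h₂ := Rel.op ht h₁ h₁ h₂
  absorb {_ p' _ _ e _} h₁ _ h₃ :=
    (h₁.lift (fun y => op t ht y y e) fun _ _ h => h.op ht h (Edge.refl _)).trans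
      (h₃.lift (fun y => op t ht p' p' y) fun _ _ h => (Edge.refl _).op ht (Edge.refl _) h)

/-- The binary operation given by `p` climbs. -/
def Reaches (p : V.Bin) : Prop :=
  ∀ t (ht : V.IsIdempotent t), termOp _ t 𝓍 𝓍 𝓏 = p.1 →
    Climbs (Rel : V.Bin → V.Bin → Prop) Le fun a u => op t ht a a u

theorem le_rel {p q : V.Bin} (h : Le p q) : ReflTransGen Rel p q := h.lift id fun _ _ h => h.rel

theorem reaches_x : Reaches (x : V.Bin) := by
  intro t ht h
  have : ∀ a u : V.Bin, op t ht a a u = a := fun a u => Subtype.ext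
    (lift_eq (Free.mem V (Fin 2)) a.1 u.1 (t := X₁) h)
  simp only [this]
  refine ⟨[fun a _ => a], ?_, by simp, fun a u _ => .refl⟩
  simpa using ⟨fun _ => rfl, fun h _ => h, fun h _ => h⟩

/-- The operations `e(x,y,z)` and `e(x,x,z)` agree when `x = y`, and at `(x,z,z)` they give the two
ends of the edge. `Climbs.step` applies with either one as `G`. -/
theorem Edge.reaches_iff {p q : V.Bin} (h : Edge p q) : Reaches p ↔ Reaches q := by
  obtain ⟨e, he, hp, hq⟩ := h
  constructor
  · intro h t ht htq
    have h1 : ∀ a u : V.Bin, Bin.op t ht a a u = Bin.op e he.isIdempotent a u u := fun a u =>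
      Subtype.ext (lift_eq' (Free.mem V (Fin 2)) a.1 u.1 (hq.trans htq.symm)).symm
    have := (h e he.isIdempotent hp).step Rel.refl (fun _ => .refl) (fun h h' => h.trans h')
      le_rel (absorbs_op_left he.isIdempotent) (absorbs_op he) fun _ _ => rfl
    simpa only [h1] using this
  · intro h t ht htp
    have h1 : ∀ a u : V.Bin, Bin.op t ht a a u = Bin.op e he.isIdempotent a a u := fun a u =>
      Subtype.ext (lift_eq (Free.mem V (Fin 2)) a.1 u.1 (htp.trans hp.symm))
    obtain ⟨_, b, hb, rfl⟩ := q
    have h2 : ∀ a u : V.Bin, Bin.op b hb a a u = Bin.op e he.isIdempotent a u u := fun a u =>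
      Subtype.ext (lift_eq' (Free.mem V (Fin 2)) a.1 u.1 hq).symm
    have := h b hb rfl
    simp only [h2] at this
    have := this.step Rel.refl (fun _ => .refl) (fun h h' => h.trans h')
      le_rel (absorbs_op he) (absorbs_op_left he.isIdempotent) fun _ _ => rfl
    simpa only [h1] using this

theorem reaches_of_eqvGen {p : V.Bin} (h : EqvGen Edge x p) : Reaches p := by
  have key : ∀ {p q : V.Bin}, EqvGen Edge p q → (Reaches p ↔ Reaches q) := by
    intro p q h
    induction h with
    | rel _ _ h => exact h.reaches_iff
    | refl => exact Iff.rfl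
    | symm _ _ _ ih => exact ih.symm
    | trans _ _ _ _ _ ih₁ ih₂ => exact ih₁.trans ih₂
  exact (key h).1 reaches_x

/-- For the second projection every iterated product collapses to its last factor `z`. -/
theorem le_of_eqvGen (h : EqvGen Edge (x : V.Bin) z) : Le (x : V.Bin) z := by
  obtain ⟨l, -, -, hl⟩ := reaches_of_eqvGen h X₃ isAbsorbing_X₃.isIdempotent rfl
  have hl2 := hl x z rel_x_z
  have : ∀ l : List (V.Bin → V.Bin → V.Bin),
      nest (fun a u => op X₃ isAbsorbing_X₃.isIdempotent a a u) x z l = z := by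
    intro l
    induction l with
    | nil => rfl
    | cons f l ih => exact Subtype.ext (congrArg Subtype.val ih)
  rwa [this] at hl2

end Bin

/-- A sequence of directed terms from an element of the order generated by the edges. -/
theorem exists_directed {p : V.Bin} (h : Bin.Le Bin.x p) :
    ∃ n : ℕ, 1 ≤ n ∧ ∃ D : ℕ → L.Term (Fin 3),
      (∀ i, V.IsAbsorbing (D i)) ∧ termOp _ (D 1) 𝓍 𝓍 𝓏 = 𝓍 ∧ termOp _ (D n) 𝓍 𝓏 𝓏 = p.1 ∧
        ∀ i, 1 ≤ i → i < n → termOp _ (D i) 𝓍 𝓏 𝓏 = termOp _ (D (i + 1)) 𝓍 𝓍 𝓏 := by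
  induction h with
  | refl => exact ⟨1, le_rfl, fun _ => X₁, fun _ => isAbsorbing_X₁, rfl, rfl, fun i _ _ => rfl⟩
  | @tail p q _ h ih =>
    obtain ⟨n, hn, D, h1, h2, h3, h4⟩ := ih
    obtain ⟨t, ht, htp, htq⟩ := h
    refine ⟨n + 1, by omega, Function.update D (n + 1) t, fun i => ?_, ?_, ?_, fun i hi hin => ?_⟩
    · by_cases h : i = n + 1
      · subst h; simpa using ht
      · simpa [Function.update_of_ne h] using h1 i
    · rwa [Function.update_of_ne (by omega)]
    · simpa using htq
    · rw [Function.update_of_ne (by omega)]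
      rcases Nat.lt_succ_iff_lt_or_eq.1 hin with h | rfl
      · rw [Function.update_of_ne (by omega)]
        exact h4 i hi h
      · simp [h3, htp]

end Variety

end UnivAlg

namespace UnivAlg

open Relation FirstOrder Language

theorem eqvGen_map {A B : Type*} {r : A → A → Prop} {s : B → B → Prop} (f : A → B)
    (hf : ∀ {a b}, r a b → EqvGen s (f a) (f b)) {a b : A} (h : EqvGen r a b) :
    EqvGen s (f a) (f b) := by
  induction h with
  | rel _ _ h => exact hf h
  | refl => exact .refl _
  | symm _ _ _ ih => exact ih.symm
  | trans _ _ _ _ _ ih₁ ih₂ => exact ih₁.trans _ _ _ ih₂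

namespace Variety

variable {L : FirstOrder.Language.{u, v}} {V : Variety L} [L.IsAlgebraic]

local notation "𝓍" => (Free.gen 0 : V.Free (Fin 2))
local notation "𝓏" => (Free.gen 1 : V.Free (Fin 2))

/-! ### Distributivity -/

theorem Bin.eqvGen_of_isAbsorbing {t : L.Term (Fin 3)} (ht : V.IsAbsorbing t) {p q : V.Bin}
    (hp : termOp _ t 𝓍 𝓍 𝓏 = p.1) (hq : termOp _ t 𝓍 𝓏 𝓏 = q.1) : EqvGen Bin.Edge p q :=
  .rel _ _ ⟨t, ht, hp, hq⟩

/-- The three kernels identify generators 0 and 2, 0 and 1, 1 and 2. Steps inside `α` preserve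
`t(x,y,x) = x`; a step in `β` fixes `t(x,x,z)`, and a step in `γ` fixes `t(x,z,z)`, so it is crossed
by one edge forwards and one backwards. -/
theorem CongruenceDistributive.eqvGen_x_z (hV : V.CongruenceDistributive) :
    EqvGen Bin.Edge (Bin.x : V.Bin) Bin.z := by
  have hF := Free.mem V (Fin 2)
  let α := Free.ker hF (![𝓍, 𝓏, 𝓍] : Fin 3 → _)
  let β := Free.ker hF (![𝓍, 𝓍, 𝓏] : Fin 3 → _)
  let γ := Free.ker hF (![𝓍, 𝓏, 𝓏] : Fin 3 → _)
  have h0 : (α ⊓ (β ⊔ γ)).r (Free.gen 0) (Free.gen 2) := by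
    refine ⟨rfl, (β ⊔ γ).iseqv.trans (y := Free.gen 1) (Congruence.sup_of_left ?_)
      (Congruence.sup_of_right ?_)⟩ <;> rfl
  rw [hV _ (Free.mem V (Fin 3)) α β γ] at h0
  have key : ∀ p, ReflTransGen (fun x y => (α ⊓ β).r x y ∨ (α ⊓ γ).r x y) (Free.gen 0) p →
      ∃ (t : L.Term (Fin 3)) (ht : V.IsAbsorbing t),
        termOp (V.Free (Fin 3)) t (Free.gen 0) (Free.gen 1) (Free.gen 2) = p ∧
          EqvGen Bin.Edge Bin.x (Bin.op t ht.isIdempotent Bin.x Bin.x Bin.z) := by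
    intro p hp
    induction hp with
    | refl => exact ⟨X₁, isAbsorbing_X₁, rfl, .refl _⟩
    | @tail p q _ hpq ih =>
      obtain ⟨t, ht, rfl, hxt⟩ := ih
      obtain ⟨s, rfl⟩ := Free.exists_termOp q
      have hα : termOp _ t 𝓍 𝓏 𝓍 = termOp _ s 𝓍 𝓏 𝓍 := by
        have : (Free.ker hF ![𝓍, 𝓏, 𝓍]).r _ _ := hpq.elim (·.1) (·.1)
        simpa [Free.lift_termOp] using Free.ker_iff.1 this
      have hs : V.IsAbsorbing s := by
        intro A _ _ hA a b
        have := congrArg (Free.lift hA ![a, b]) hα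
        simp only [Free.lift_termOp] at this
        exact this.symm.trans (ht A hA a b)
      refine ⟨s, hs, rfl, ?_⟩
      rcases hpq with h | h
      · have : termOp _ t 𝓍 𝓍 𝓏 = termOp _ s 𝓍 𝓍 𝓏 := by
          have : (Free.ker hF ![𝓍, 𝓍, 𝓏]).r _ _ := h.2
          simpa [Free.lift_termOp] using Free.ker_iff.1 this
        have e : Bin.op t ht.isIdempotent Bin.x Bin.x Bin.z =
          Bin.op s hs.isIdempotent Bin.x Bin.x Bin.z := Subtype.ext this
        rwa [← e]
      · have : termOp _ t 𝓍 𝓏 𝓏 = termOp _ s 𝓍 𝓏 𝓏 := by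
          have : (Free.ker hF ![𝓍, 𝓏, 𝓏]).r _ _ := h.2
          simpa [Free.lift_termOp] using Free.ker_iff.1 this
        refine (hxt.trans _ _ _ (Bin.eqvGen_of_isAbsorbing
          (q := Bin.op t ht.isIdempotent Bin.x Bin.z Bin.z) ht rfl rfl)).trans _ _ _ (.symm _ _ ?_)
        exact Bin.eqvGen_of_isAbsorbing hs rfl this.symm
  obtain ⟨t, ht, h1, h2⟩ := key _ (Congruence.reflTransGen_of_sup h0)
  have h3 : termOp _ t 𝓍 𝓍 𝓏 = 𝓏 := by
    simpa [Free.lift_termOp] using congrArg (Free.lift hF ![𝓍, 𝓍, 𝓏]) h1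
  have e : Bin.op t ht.isIdempotent Bin.x Bin.x Bin.z = Bin.z := Subtype.ext h3
  rwa [e] at h2

/-! ### Modularity -/

variable (V) in
/-- `t` satisfies `t(x, y, y, x) = x` in `V`. -/
def IsDay (t : L.Term (Fin 4)) : Prop :=
  ∀ (A : Type u) [L.Structure A] [Nonempty A], V.Mem A → ∀ a b : A, termOp₄ A t a b b a = a

omit [L.IsAlgebraic] in
theorem IsDay.isIdempotent {t : L.Term (Fin 4)} (ht : V.IsDay t) : V.IsIdempotent₄ t :=
  fun A _ _ hA a => ht A hA a a

variable (V) in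
/-- Consecutive terms in a sequence of Day terms. -/
def DayStep (s t : L.Term (Fin 4)) : Prop :=
  V.IsDay s ∧ V.IsDay t ∧
    ((∀ (A : Type u) [L.Structure A] [Nonempty A], V.Mem A →
        ∀ a b c : A, termOp₄ A s a b b c = termOp₄ A t a b b c) ∨
      ∀ (A : Type u) [L.Structure A] [Nonempty A], V.Mem A →
        ∀ a b : A, termOp₄ A s a a b b = termOp₄ A t a a b b)

/-- Day's argument: `γ` identifies generators 1 and 2, `α` identifies 0 with 1 and 2 with 3, and `β`
identifies 0 with 3 and 1 with 2. The modular law for `γ ≤ β` yields a chain from generator 0 to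
generator 3 along `γ` and `α ⊓ β`. -/
theorem CongruenceModular.exists_day (hV : V.CongruenceModular) :
    ∃ t : L.Term (Fin 4), ReflTransGen V.DayStep (Term.var 0) t ∧
      ∀ (A : Type u) [L.Structure A] [Nonempty A], V.Mem A →
        ∀ a b c d : A, termOp₄ A t a b c d = d := by
  have hF := Free.mem V (Fin 2)
  let x₃ : Fin 3 → V.Free (Fin 3) := Free.gen
  let α := Free.ker hF (![𝓍, 𝓍, 𝓏, 𝓏] : Fin 4 → _)
  let β := Free.ker hF (![𝓍, 𝓏, 𝓏, 𝓍] : Fin 4 → _)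
  let γ := Free.ker (Free.mem V (Fin 3)) (![x₃ 0, x₃ 1, x₃ 1, x₃ 2] : Fin 4 → _)
  have hγβ : γ ≤ β := by
    refine Congruence.le_def.2 fun p q h => ?_
    obtain ⟨s, rfl⟩ := Free.exists_termOp₄ p
    obtain ⟨t, rfl⟩ := Free.exists_termOp₄ q
    have := congrArg (Free.lift hF ![𝓍, 𝓏, 𝓍]) (show Free.lift _ _ _ = Free.lift _ _ _ from h)
    refine Free.ker_iff.2 ?_
    simpa [Free.lift_termOp₄, x₃] using this
  have h0 : ((γ ⊔ α) ⊓ β).r (Free.gen 0) (Free.gen 3) := by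
    refine ⟨(γ ⊔ α).iseqv.trans (y := Free.gen 1) (Congruence.sup_of_right ?_)
      ((γ ⊔ α).iseqv.trans (y := Free.gen 2) (Congruence.sup_of_left ?_)
      (Congruence.sup_of_right ?_)), ?_⟩ <;> rfl
  have := hV _ (Free.mem V (Fin 4))
  have h1 := Congruence.le_def.1 (IsModularLattice.sup_inf_le_assoc_of_le α hγβ) _ _ h0
  have key : ∀ p, ReflTransGen (fun x y => γ.r x y ∨ (α ⊓ β).r x y) (Free.gen 0) p →
      ∃ t : L.Term (Fin 4),
        termOp₄ (V.Free (Fin 4)) t (Free.gen 0) (Free.gen 1) (Free.gen 2) (Free.gen 3) = p ∧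
          V.IsDay t ∧ ReflTransGen V.DayStep (Term.var 0) t := by
    intro p hp
    induction hp with
    | refl => exact ⟨Term.var 0, rfl, fun _ _ _ _ _ _ => rfl, .refl⟩
    | @tail p q _ hpq ih =>
      obtain ⟨s, rfl, hs, hst⟩ := ih
      obtain ⟨t, rfl⟩ := Free.exists_termOp₄ q
      have hβ : termOp₄ _ s 𝓍 𝓏 𝓏 𝓍 = termOp₄ _ t 𝓍 𝓏 𝓏 𝓍 := by
        have : (Free.ker hF ![𝓍, 𝓏, 𝓏, 𝓍]).r _ _ :=
          hpq.elim (Congruence.le_def.1 hγβ _ _) (·.2)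
        simpa [Free.lift_termOp₄] using Free.ker_iff.1 this
      have ht : V.IsDay t := by
        intro A _ _ hA a b
        have := congrArg (Free.lift hA ![a, b]) hβ
        simp only [Free.lift_termOp₄] at this
        exact this.symm.trans (hs A hA a b)
      refine ⟨t, rfl, ht, hst.tail ⟨hs, ht, hpq.imp (fun h A _ _ hA a b c => ?_)
        (fun h A _ _ hA a b => ?_)⟩⟩
      · have := congrArg (Free.lift hA ![a, b, c])
          (show Free.lift _ _ _ = Free.lift _ _ _ from h)
        simpa [Free.lift_termOp₄, x₃] using this
      · have := congrArg (Free.lift hA ![a, b])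
          (show Free.lift _ _ _ = Free.lift _ _ _ from h.1)
        simpa [Free.lift_termOp₄] using this
  obtain ⟨t, h2, -, h3⟩ := key _ (Congruence.reflTransGen_of_sup h1)
  refine ⟨t, h3, fun A _ _ hA a b c d => ?_⟩
  simpa [Free.lift_termOp₄] using congrArg (Free.lift hA ![a, b, c, d]) h2

namespace Bin

theorem eqvGen_op₄ {t : L.Term (Fin 4)} (ht : V.IsIdempotent₄ t) (c d : V.Bin) {p q : V.Bin}
    (h : EqvGen Edge p q) : EqvGen Edge (op₄ t ht p c d p) (op₄ t ht q c d q) :=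
  eqvGen_map (fun p => op₄ t ht p c d p)
    (fun h => .rel _ _ (Edge.op₄ ht h (Edge.refl _) (Edge.refl _) h)) h

/-- A form of the shifting principle: the elements `s(p,c,c,q)` are followed along the Day terms
from `p` to `q`, with a detour through `s(p,p,q,q)` wherever consecutive terms agree only there. -/
theorem eqvGen_of_day {t : L.Term (Fin 4)} (hday : ReflTransGen V.DayStep (Term.var 0) t)
    (htop : ∀ (A : Type u) [L.Structure A] [Nonempty A], V.Mem A →
        ∀ a b c d : A, termOp₄ A t a b c d = d) {p q c : V.Bin}
    (h : ∀ s (hs : V.IsDay s), EqvGen Edge (op₄ s hs.isIdempotent p p q q)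
      (op₄ s hs.isIdempotent p c c q)) : EqvGen Edge p q := by
  have hF := Free.mem V (Fin 2)
  have key : ∀ s, ReflTransGen V.DayStep (Term.var 0) s → ∃ hs : V.IsDay s,
      EqvGen Edge p (op₄ s hs.isIdempotent p c c q) := by
    intro s hs
    induction hs with
    | refl => exact ⟨fun _ _ _ _ _ _ => rfl, .refl _⟩
    | @tail s t _ hst ih =>
      obtain ⟨hs, ht, hst⟩ := hst
      obtain ⟨_, ih⟩ := ih
      refine ⟨ht, ?_⟩
      rcases hst with hst | hst
      · have e : op₄ s hs.isIdempotent p c c q = op₄ t ht.isIdempotent p c c q :=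
          Subtype.ext (hst _ hF _ _ _)
        rwa [← e]
      · have e : op₄ s hs.isIdempotent p p q q = op₄ t ht.isIdempotent p p q q :=
          Subtype.ext (hst _ hF _ _)
        exact (ih.trans _ _ _ (e ▸ (h s hs).symm)).trans _ _ _ (h t ht)
  obtain ⟨ht, h⟩ := key t hday
  have e : op₄ t ht.isIdempotent p c c q = q := Subtype.ext (htop _ hF _ _ _ _)
  rwa [e] at h

section Day

variable {t : L.Term (Fin 4)} (hday : ReflTransGen V.DayStep (Term.var 0) t)
    (htop : ∀ (A : Type u) [L.Structure A] [Nonempty A], V.Mem A →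
        ∀ a b c d : A, termOp₄ A t a b c d = d)

include hday htop

theorem eqvGen_expand {m : L.Term (Fin 4)} (hm : V.IsDay m) :
    EqvGen Edge (op₄ m hm.isIdempotent (op₄ m hm.isIdempotent x x x z) x z
      (op₄ m hm.isIdempotent x x x z)) (op₄ m hm.isIdempotent x x z z) := by
  have hF := Free.mem V (Fin 2)
  have h1 : EqvGen Edge (op₄ m hm.isIdempotent x x x z : V.Bin)
      (op₄ m hm.isIdempotent x z z z) :=
    eqvGen_of_isAbsorbing (t := comp₄ m X₁ X₂ X₂ X₃)
      (fun A _ _ hA a b => by simpa using hm A hA a b) (termOp_comp₄ _ _ _ _ _ _ _ _)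
      (termOp_comp₄ _ _ _ _ _ _ _ _)
  refine (eqvGen_op₄ hm.isIdempotent _ _ h1).trans _ _ _ ?_
  refine eqvGen_of_day hday htop (c := op₄ m hm.isIdempotent x z z z) fun s hs => ?_
  let a : L.Term (Fin 3) := comp₄ m X₁ X₃ X₃ X₃
  -- At `y = x` the inner arguments of `s` repeat the outer ones; at `y = z` both become
  -- `m(x,z,z,z)`. For `z = x` the two inner arguments coincide, so Day's identity for `s` gives
  -- absorption.
  refine eqvGen_of_isAbsorbing (t := comp₄ s (comp₄ m a X₁ X₃ a) (comp₄ m a X₂ X₃ a)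
    (comp₄ m X₁ X₂ X₃ X₃) (comp₄ m X₁ X₁ X₃ X₃)) (fun A _ _ hA _ _ => ?_) ?_ ?_
  · simp [a, hm.isIdempotent A hA, hs A hA]
  · simp [a, op₄, x, z]
  · simp [a, op₄, x, z, hm _ hF]

theorem eqvGen_contract {m : L.Term (Fin 4)} (hm : V.IsDay m) :
    EqvGen Edge (op₄ m hm.isIdempotent (op₄ m hm.isIdempotent x x z z) z x
      (op₄ m hm.isIdempotent x x z z)) (op₄ m hm.isIdempotent x x x z) := by
  have hF := Free.mem V (Fin 2)
  refine eqvGen_of_day hday htop (c := op₄ m hm.isIdempotent x x z z) fun s hs => ?_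
  let a : L.Term (Fin 3) := comp₄ m X₁ X₁ X₃ X₃
  refine eqvGen_of_isAbsorbing (t := comp₄ s (comp₄ m a X₃ X₁ a) (comp₄ m a X₃ X₂ a)
    (comp₄ m X₁ X₁ X₂ X₃) (comp₄ m X₁ X₁ X₁ X₃)) (fun A _ _ hA _ _ => ?_) ?_ ?_
  · simp [a, hm.isIdempotent A hA, hs A hA]
  · simp [a, op₄, x, z]
  · simp [a, op₄, x, z, hm _ hF]

/-- Induction along the Day terms: at generator 3, where `m(x,x,x,z) = z`, the term `p` satisfies
`p(x,y,y) = x` and `p(x,x,z)` is joined to `z` by a fence. -/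
theorem exists_halfMaltsev {m : L.Term (Fin 4)}
    (h : ReflTransGen V.DayStep (Term.var 0) m) :
    ∃ (hm : V.IsDay m) (p : L.Term (Fin 3)) (hp : V.IsIdempotent p),
      (∀ (A : Type u) [L.Structure A] [Nonempty A], V.Mem A →
        ∀ a b : A, termOp A p a b b = a) ∧
      EqvGen Edge (op p hp x x z) (op₄ m hm.isIdempotent x x x z) := by
  have hF := Free.mem V (Fin 2)
  induction h with
  | refl => exact ⟨fun _ _ _ _ _ _ => rfl, X₁, isAbsorbing_X₁.isIdempotent,
      fun _ _ _ _ _ _ => rfl, .refl _⟩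
  | @tail m n _ hmn ih =>
    obtain ⟨hm, hn, hmn⟩ := hmn
    obtain ⟨_, p, hp, hpm, hpx⟩ := ih
    rcases hmn with hmn | hmn
    · refine ⟨hn, p, hp, hpm, ?_⟩
      have e : op₄ m hm.isIdempotent x x x z = (op₄ n hn.isIdempotent x x x z : V.Bin) :=
        Subtype.ext (hmn _ hF _ _ _)
      rwa [← e]
    -- At `y = z` both layers disappear by Day's identity. At `y = x` the inner layer leads to
    -- `m(x,x,z,z) = n(x,x,z,z)` by `eqvGen_expand`, and the outer one back to `n(x,x,x,z)` by
    -- `eqvGen_contract`.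
    · let r := comp₄ m p X₂ X₃ p
      let q := comp₄ n r X₃ X₂ r
      have hq : ∀ (A : Type u) [L.Structure A] [Nonempty A], V.Mem A →
          ∀ a b : A, termOp A q a b b = a := by
        intro A _ _ hA a b
        simp [q, r, hn A hA, hm A hA, hpm A hA]
      refine ⟨hn, q, fun A _ _ hA a => hq A hA a a, hq, ?_⟩
      have e1 : op q (fun A _ _ hA a => hq A hA a a) x x z =
          (op₄ n hn.isIdempotent (op₄ m hm.isIdempotent (op p hp x x z) x z (op p hp x x z)) z x
            (op₄ m hm.isIdempotent (op p hp x x z) x z (op p hp x x z)) : V.Bin) :=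
        Subtype.ext (by simp [q, r, op, op₄])
      have e2 : op₄ m hm.isIdempotent x x z z = (op₄ n hn.isIdempotent x x z z : V.Bin) :=
        Subtype.ext (hmn _ hF _ _)
      have h1 := (eqvGen_op₄ hm.isIdempotent x z hpx).trans _ _ _ (eqvGen_expand hday htop hm)
      rw [e2] at h1
      rw [e1]
      exact (eqvGen_op₄ hn.isIdempotent z x h1).trans _ _ _ (eqvGen_contract hday htop hn)

end Day

/-- The automorphism exchanging the generators. -/
noncomputable def swap (p : V.Bin) : V.Bin :=
  ⟨Free.lift (Free.mem V (Fin 2)) ![𝓏, 𝓍] p.1, by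
    obtain ⟨_, t, ht, rfl⟩ := p
    refine ⟨comp t X₃ X₃ X₁, ht.comp isAbsorbing_X₃.isIdempotent isAbsorbing_X₃.isIdempotent
      isAbsorbing_X₁.isIdempotent, ?_⟩
    simp [Free.lift_termOp]⟩

theorem Edge.swap {p q : V.Bin} : Edge p q → Edge (swap q) (Bin.swap p) := by
  rintro ⟨t, ht, hp, hq⟩
  refine ⟨comp t X₃ X₂ X₁, fun A _ _ hA a b => by simp [ht A hA], ?_, ?_⟩
  · simp [Bin.swap, ← hq, Free.lift_termOp]
  · simp [Bin.swap, ← hp, Free.lift_termOp]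

theorem eqvGen_swap {p q : V.Bin} (h : EqvGen Edge p q) : EqvGen Edge (swap p) (swap q) :=
  eqvGen_map swap (fun h => .symm _ _ (.rel _ _ h.swap)) h

end Bin

theorem CongruenceModular.exists_halfMaltsev (hV : V.CongruenceModular) :
    ∃ (q : L.Term (Fin 3)) (hq : V.IsIdempotent q),
      (∀ (A : Type u) [L.Structure A] [Nonempty A], V.Mem A →
        ∀ a b : A, termOp A q a a b = b) ∧
      EqvGen Bin.Edge Bin.x (Bin.op q hq Bin.x Bin.z Bin.z) := by
  obtain ⟨t, hday, htop⟩ := hV.exists_day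
  obtain ⟨ht, p, hp, hp1, hp2⟩ := Bin.exists_halfMaltsev hday htop hday
  have hq : ∀ (A : Type u) [L.Structure A] [Nonempty A], V.Mem A →
      ∀ a b : A, termOp A (comp p X₃ X₂ X₁) a a b = b := fun A _ _ hA a b => by
    simp [hp1 A hA]
  refine ⟨comp p X₃ X₂ X₁, fun A _ _ hA a => hq A hA a a, hq, ?_⟩
  have h := Bin.eqvGen_swap hp2
  have e1 : Bin.swap (Bin.op p hp Bin.x Bin.x Bin.z) =
      (Bin.op (comp p X₃ X₂ X₁) (fun A _ _ hA a => hq A hA a a) Bin.x Bin.z Bin.z : V.Bin) :=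
    Subtype.ext (by simp [Bin.swap, Bin.op, Bin.x, Bin.z, Free.lift_termOp])
  have e2 : Bin.swap (Bin.op₄ t ht.isIdempotent Bin.x Bin.x Bin.x Bin.z) = (Bin.x : V.Bin) :=
    Subtype.ext (by
      simp [Bin.swap, Bin.op₄, Bin.x, Bin.z, htop _ (Free.mem V (Fin 2))])
  rw [e1, e2] at h
  exact h.symm

theorem CongruenceModular.exists_climb (hV : V.CongruenceModular) :
    ∃ (p : V.Bin) (t : L.Term (Fin 3)), Bin.Le Bin.x p ∧
      (∀ (A : Type u) [L.Structure A] [Nonempty A], V.Mem A →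
        ∀ a b : A, termOp A t a a b = b) ∧ termOp _ t 𝓍 𝓏 𝓏 = p.1 := by
  have hF := Free.mem V (Fin 2)
  obtain ⟨q, hq, hq1, hq2⟩ := hV.exists_halfMaltsev
  have hs : V.IsIdempotent (comp q X₁ X₃ X₃) := hq.comp isAbsorbing_X₁.isIdempotent
    isAbsorbing_X₃.isIdempotent isAbsorbing_X₃.isIdempotent
  obtain ⟨l, hl, hpair, hclimb⟩ := Bin.reaches_of_eqvGen hq2 _ hs (by simp [Bin.op, Bin.x, Bin.z])
  set s : V.Bin → V.Bin → V.Bin := fun a u => Bin.op (comp q X₁ X₃ X₃) hs a a u with hs_def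
  refine ⟨nest s Bin.x Bin.z l, ?_⟩
  suffices ∀ m : List (V.Bin → V.Bin → V.Bin), (∀ f ∈ m, PreservesBin Bin.Rel Bin.Le f) →
      m.Pairwise (fun f g => ∀ a u, Bin.Rel a u → Bin.Rel (f a u) (g a u)) →
      ∃ t : L.Term (Fin 3), (∀ (A : Type u) [L.Structure A] [Nonempty A], V.Mem A →
        ∀ a b : A, termOp A t a a b = b) ∧
        termOp _ t 𝓍 𝓏 𝓏 = (nest s (Bin.x : V.Bin) Bin.z m).1 by
    obtain ⟨t, h⟩ := this l hl hpair
    exact ⟨t, hclimb _ _ Bin.rel_x_z, h⟩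
  intro m
  induction m with
  | nil => exact fun _ _ => ⟨X₃, fun _ _ _ _ _ _ => rfl, rfl⟩
  | cons f m ih =>
    intro hm hp
    obtain ⟨h1, h2⟩ := List.forall_mem_cons.1 hm
    obtain ⟨p1, p2⟩ := List.pairwise_cons.1 hp
    obtain ⟨t, ht1, ht2⟩ := ih h2 p2
    have hfz : Bin.Rel (f Bin.x Bin.z) (Bin.z : V.Bin) := by
      have := h1.rel (Bin.rel_x_z (V := V)) (Bin.Rel.refl Bin.z)
      rwa [h1.idem] at this
    obtain ⟨g, -, hg1, hg2⟩ : Bin.Rel (f Bin.x Bin.z) (nest s Bin.x Bin.z m) :=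
      nest_above (fun a => Subtype.ext (hs _ hF _)) (fun h h' => Bin.Rel.op hs h h h') hfz
        fun g hg => p1 g hg _ _ Bin.rel_x_z
    obtain ⟨e, he, hef⟩ := (f Bin.x Bin.z : V.Bin).2
    have heg : ∀ (A : Type u) [L.Structure A] [Nonempty A], V.Mem A →
        ∀ a b : A, termOp A g a a b = termOp A e a a b := fun A _ _ hA a b =>
      Bin.lift_eq hA a b (hg1.trans hef.symm)
    -- The term `g` witnesses that `f` is related to the remaining product: it equals `f` at
    -- `(x,x,z)`, where `q(f,f,t) = t = z`, and equals that product at `(x,z,z)`, where `q` becomes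
    -- the factor `s`.
    refine ⟨comp q (comp e X₁ X₁ X₃) g t, fun A _ _ hA a b => ?_, ?_⟩
    · simp [ht1 A hA, heg A hA, hq1 A hA]
    · simp [hef, hg2, ht2, nest, s, Bin.op]

end Variety

end UnivAlg

namespace UnivAlg

open Relation FirstOrder Language

/-! ### Consequences of the equations for the congruences of an algebra -/

section Algebra

variable {L : FirstOrder.Language.{u, v}} {A : Type w} [L.Structure A]

theorem Congruence.sup_of_joinRel {β γ : Congruence L A} {k : ℕ} : ∀ {a b : A},
    joinRel β γ k a b → (β ⊔ γ).r a b := by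
  induction k with
  | zero => exact fun h => sup_of_left h
  | succ k ih =>
    rintro a b ⟨c, d, h₁, h₂, h₃⟩
    exact (β ⊔ γ).iseqv.trans (ih h₁) ((β ⊔ γ).iseqv.trans (sup_of_right h₂) (ih h₃))

theorem Congruence.absorb_sup {t : L.Term (Fin 3)} (ht : ∀ x y : A, UnivAlg.termOp A t x y x = x)
    {α β γ θ : Congruence L A} (hβ : α ⊓ β ≤ θ) (hγ : α ⊓ γ ≤ θ) {a b c d : A} (hab : α.r a b)
    (h : (β ⊔ γ).r c d) : θ.r (UnivAlg.termOp A t a c b) (UnivAlg.termOp A t a d b) := by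
  have hα : ∀ c, α.r (UnivAlg.termOp A t a c b) a := fun c => by
    have := α.termOp t (α.iseqv.refl a) (α.iseqv.refl c) (α.iseqv.symm hab)
    rwa [ht] at this
  replace h := reflTransGen_of_sup h
  induction h with
  | refl => exact θ.iseqv.refl _
  | @tail c d _ hcd ih =>
    refine θ.iseqv.trans ih ?_
    have hαcd := α.iseqv.trans (hα c) (α.iseqv.symm (hα d))
    rcases hcd with hcd | hcd
    · exact le_def.1 hβ _ _ ⟨hαcd, β.termOp t (β.iseqv.refl a) hcd (β.iseqv.refl b)⟩
    · exact le_def.1 hγ _ _ ⟨hαcd, γ.termOp t (γ.iseqv.refl a) hcd (γ.iseqv.refl b)⟩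

theorem Congruence.related_of_directed {n : ℕ} {D : ℕ → L.Term (Fin 3)}
    (first : ∀ x y : A, UnivAlg.termOp A (D 1) x x y = x)
    (middle : ∀ i, 1 ≤ i → i ≤ n → ∀ x y : A, UnivAlg.termOp A (D i) x y x = x)
    (step : ∀ i, 1 ≤ i → i < n → ∀ x y : A,
      UnivAlg.termOp A (D i) x y y = UnivAlg.termOp A (D (i + 1)) x x y)
    {α β γ θ : Congruence L A} (hβ : α ⊓ β ≤ θ) (hγ : α ⊓ γ ≤ θ) {a b : A} (hab : α.r a b)
    (h : (β ⊔ γ).r a b) (i : ℕ) (hi : 1 ≤ i) (hin : i ≤ n) :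
    θ.r a (UnivAlg.termOp A (D i) a b b) := by
  induction i, hi using Nat.le_induction with
  | base =>
    have := absorb_sup (middle 1 le_rfl hin) hβ hγ hab h
    rwa [first] at this
  | succ i hi ih =>
    have := absorb_sup (middle (i + 1) (by omega) hin) hβ hγ hab h
    rw [← step i hi (by omega)] at this
    exact θ.iseqv.trans (ih (by omega)) this

theorem IsDirectedJonsson.distributive {n : ℕ} (hn : 1 ≤ n) {D : ℕ → L.Term (Fin 3)}
    (h : IsDirectedJonsson n fun i => termOp A (D i)) (α β γ : Congruence L A) :
    α ⊓ (β ⊔ γ) = (α ⊓ β) ⊔ (α ⊓ γ) := by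
  refine le_antisymm (Congruence.le_def.2 fun a b hab => ?_) le_inf_sup
  have := Congruence.related_of_directed h.first h.middle h.step le_sup_left le_sup_right
    hab.1 hab.2 n hn le_rfl
  rwa [h.last] at this

theorem IsDirectedGumm.modular {n : ℕ} (hn : 1 ≤ n) {D : ℕ → L.Term (Fin 3)}
    {q : L.Term (Fin 3)} (h : IsDirectedGumm n (fun i => termOp A (D i)) (termOp A q)) :
    IsModularLattice (Congruence L A) := by
  refine ⟨fun {γ} β {α} hγα => ?_⟩
  set θ := γ ⊔ β ⊓ α
  have hβ : α ⊓ β ≤ θ := inf_comm α β ▸ le_sup_right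
  have hγθ : γ ≤ θ := le_sup_left
  have hq : ∀ {a b}, α.r a b → (β ⊔ γ).r a b → θ.r a (termOp A q a b b) := by
    intro a b hα hab
    have := Congruence.related_of_directed h.first h.middle h.step hβ
      (inf_le_right.trans hγθ) hα hab n hn le_rfl
    rwa [h.last] at this
  have key : ∀ k a b, Congruence.joinRel β γ k a b → α.r a b → θ.r a b := by
    intro k
    induction k with
    | zero => exact fun a b hab hα => Congruence.le_def.1 hβ _ _ ⟨hα, hab⟩
    | succ k ih =>
      intro a b hab hα
      have h1 := hq hα (Congruence.sup_of_joinRel hab)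
      obtain ⟨c, d, hac, hcd, hdb⟩ := hab
      have refl := α.iseqv.refl
      -- Both halves of a chain of level `k + 1` have level `k`, so moving `a` to `c` and `b` to `d`
      -- simultaneously stays at level `k` and the induction hypothesis applies.
      have h2 : θ.r (termOp A q a b b) (termOp A q c d b) := by
        refine ih _ _ (Congruence.joinRel_termOp q hac (Congruence.joinRel_symm hdb)
          (Congruence.joinRel_refl k b)) ?_
        have e1 := α.termOp q hα (refl b) (refl b)
        have e2 := α.termOp q (Congruence.le_def.1 hγα _ _ hcd) (refl d) (refl b)
        rw [h.maltsev] at e1 e2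
        exact α.iseqv.trans e1 (α.iseqv.symm e2)
      have h3 := γ.termOp q hcd (γ.iseqv.refl d) (γ.iseqv.refl b)
      rw [h.maltsev] at h3
      exact θ.iseqv.trans h1 (θ.iseqv.trans h2 (Congruence.le_def.1 hγθ _ _ h3))
  refine Congruence.le_def.2 fun a b hab => ?_
  obtain ⟨k, hk⟩ := Congruence.exists_joinRel (sup_comm γ β ▸ hab.1)
  exact key k a b hk hab.2

theorem IsPixley.distributive {n : ℕ} (hn : 1 ≤ n) {P : ℕ → L.Term (Fin 3)}
    (h : IsPixley n fun i => termOp A (P i)) (α β γ : Congruence L A) :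
    α ⊓ (β ⊔ γ) = (α ⊓ β) ⊔ (α ⊓ γ) := by
  refine le_antisymm (Congruence.le_def.2 fun a b hab => ?_) le_inf_sup
  set θ := (α ⊓ β) ⊔ (α ⊓ γ)
  have key : ∀ i, 1 ≤ i → i ≤ n → θ.r a (termOp A (P i) a a b) := by
    intro i hi
    induction i, hi using Nat.le_induction with
    | base =>
      intro hin
      have := Congruence.absorb_sup (h.middle 1 le_rfl hin) (θ := θ) le_sup_left le_sup_right
        hab.1 ((β ⊔ γ).iseqv.symm hab.2)
      rwa [h.first] at this
    | succ i hi ih =>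
      intro hin
      have := Congruence.absorb_sup (h.middle (i + 1) (by omega) hin) (θ := θ) le_sup_left
        le_sup_right hab.1 ((β ⊔ γ).iseqv.symm hab.2)
      rw [← h.step i hi (by omega)] at this
      exact θ.iseqv.trans (ih (by omega)) this
  have := key n hn le_rfl
  rwa [h.last] at this

theorem altComp_iff {A : Type w} {m : ℕ} : ∀ {r s : A → A → Prop} {a b : A},
    altComp m r s a b ↔ ∃ c : ℕ → A, c 0 = a ∧ c m = b ∧
      ∀ i < m, (Even i → r (c i) (c (i + 1))) ∧ (¬ Even i → s (c i) (c (i + 1))) := by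
  induction m with
  | zero =>
    intro r s a b
    constructor
    · rintro rfl
      exact ⟨fun _ => a, rfl, rfl, fun i hi => absurd hi (by omega)⟩
    · rintro ⟨c, rfl, rfl, -⟩
      rfl
  | succ m ih =>
    intro r s a b
    constructor
    · rintro ⟨d, had, hdb⟩
      obtain ⟨c, rfl, rfl, hc⟩ := ih.1 hdb
      refine ⟨fun i => Nat.casesOn i a c, rfl, rfl, fun i hi => ?_⟩
      cases i with
      | zero => exact ⟨fun _ => had, fun h => absurd Even.zero h⟩
      | succ i =>
        have := hc i (by omega)
        rw [Nat.even_add_one, not_not]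
        exact ⟨this.2, this.1⟩
    · rintro ⟨c, rfl, rfl, hc⟩
      refine ⟨c 1, (hc 0 (by omega)).1 Even.zero, ih.2 ⟨fun i => c (i + 1), rfl, rfl, ?_⟩⟩
      intro i hi
      have := hc (i + 1) (by omega)
      rw [Nat.even_add_one, not_not] at this
      exact ⟨this.2, this.1⟩

/-- The new chain is `P i (c (i - 1)) (c i) (c (i + 1))`. Neighbours are linked through `P i (c i)
(c i) (c (i + 1)) = P (i + 1) (c i) (c (i + 1)) (c (i + 1))`; both links lie in the same congruence,
as the factors have period two. -/
theorem IsPixley.altComp {k : ℕ} (hk : 1 ≤ k) {P : ℕ → L.Term (Fin 3)}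
    (h : IsPixley k fun i => termOp A (P i)) {α β : Congruence L A} {a b : A}
    (hab : altComp (k + 1) α.r β.r a b) : UnivAlg.altComp (k + 1) β.r α.r a b := by
  obtain ⟨c, rfl, rfl, hc⟩ := altComp_iff.1 hab
  let ρ : ℕ → Congruence L A := fun i => if Even i then α else β
  have hα : ∀ {i}, Even i → ρ i = α := fun h => if_pos h
  have hβ : ∀ {i}, ¬ Even i → ρ i = β := fun h => if_neg h
  have hρ : ∀ i, ρ (i + 2) = ρ i := fun i => by simp [ρ, Nat.even_add]
  have hcρ : ∀ i < k + 1, (ρ i).r (c i) (c (i + 1)) := by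
    intro i hi
    by_cases he : Even i
    · exact hα he ▸ (hc i hi).1 he
    · exact hβ he ▸ (hc i hi).2 he
  let e : ℕ → A := fun i => if i = 0 then c 0 else if i = k + 1 then c (k + 1) else
    termOp A (P i) (c (i - 1)) (c i) (c (i + 1))
  have he : ∀ i, 1 ≤ i → i ≤ k → e i = termOp A (P i) (c (i - 1)) (c i) (c (i + 1)) :=
    fun i h1 h2 => by simp [e, show i ≠ 0 by omega, show i ≠ k + 1 by omega]
  have left : ∀ i < k, (ρ (i + 1)).r (termOp A (P (i + 1)) (c i) (c (i + 1)) (c (i + 1)))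
      (e (i + 1)) := by
    intro i hi
    rw [he _ (by omega) (by omega)]
    exact (ρ (i + 1)).termOp _ ((ρ (i + 1)).iseqv.refl _) ((ρ (i + 1)).iseqv.refl _)
      (hcρ _ (by omega))
  have right : ∀ i < k, (ρ i).r (e (i + 1))
      (termOp A (P (i + 1)) (c (i + 1)) (c (i + 1)) (c (i + 2))) := by
    intro i hi
    rw [he _ (by omega) (by omega)]
    exact (ρ i).termOp _ (hcρ _ (by omega)) ((ρ i).iseqv.refl _) ((ρ i).iseqv.refl _)
  have step : ∀ i < k + 1, (ρ (i + 1)).r (e i) (e (i + 1)) := by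
    intro i hi
    cases i with
    | zero =>
      have := left 0 hk
      rwa [h.first] at this
    | succ i =>
      have h1 := right i (by omega)
      rw [← hρ] at h1
      rcases Nat.lt_or_ge (i + 1) k with h2 | h2
      · rw [h.step _ (by omega) h2] at h1
        exact (ρ _).iseqv.trans h1 (left (i + 1) h2)
      · obtain rfl : k = i + 1 := by omega
        rw [h.last] at h1
        simpa [e] using h1
  refine altComp_iff.2 ⟨e, by simp [e], by simp [e], fun i hi => ?_⟩
  have := step i hi
  constructor
  · intro hi
    exact hβ (i := i + 1) (by simpa [Nat.even_add_one] using hi) ▸ this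
  · intro hi
    exact hα (i := i + 1) (by simpa [Nat.even_add_one] using hi) ▸ this

end Algebra

/-! ### Chains of bounded length -/

section Chain

variable {B : Type w}

/-- `p` and `q` are joined by a chain of `k` steps. -/
def Chain (R : B → B → Prop) (k : ℕ) (p q : B) : Prop :=
  ∃ c : ℕ → B, c 0 = p ∧ c k = q ∧ ∀ i < k, R (c i) (c (i + 1))

/-- The equations of Hagemann and Mitschke. -/
structure IsHagemannMitschke (k : ℕ) (h : ℕ → B → B → B → B) : Prop where
  first : ∀ x y, h 1 x y y = x
  last : ∀ x y, h k x x y = y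
  step : ∀ i, 1 ≤ i → i < k → ∀ x y, h i x x y = h (i + 1) x y y

variable {R : B → B → Prop} {k : ℕ} {h : ℕ → B → B → B → B}

theorem IsHagemannMitschke.idem (hh : IsHagemannMitschke k h) (x : B) (i : ℕ) (hi : 1 ≤ i)
    (hik : i ≤ k) : h i x x x = x := by
  induction i, hi using Nat.le_induction with
  | base => exact hh.first x x
  | succ i hi ih => rw [← hh.step i hi (by omega), ih (by omega)]

/-- The elements `h i (c i) (c i) (c (i + 1)) = h (i + 1) (c i) (c (i + 1)) (c (i + 1))` form the
new chain: moving each argument at most one step along `c` leads to the next one. -/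
theorem IsHagemannMitschke.shorten (hh : IsHagemannMitschke k h) (hk : 1 ≤ k)
    (hRh : ∀ i, 1 ≤ i → i ≤ k → ∀ {a a' b b' c c'}, R a a' → R b b' → R c c' →
      R (h i a b c) (h i a' b' c')) (hR : ∀ a, R a a) {p q : B}
    (hpq : Chain R (k + 1) p q) : Chain R k p q := by
  obtain ⟨c, rfl, rfl, hc⟩ := hpq
  refine ⟨fun i => if i = 0 then c 0 else h i (c i) (c i) (c (i + 1)), by simp,
    by simp [show k ≠ 0 by omega, hh.last], fun i hi => ?_⟩
  have h1 := hRh (i + 1) (by omega) (by omega) (hc i (by omega)) (hR (c (i + 1)))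
    (hc (i + 1) (by omega))
  cases i with
  | zero => simpa [hh.first] using h1
  | succ i => simpa [hh.step (i + 1) (by omega) hi] using h1

/-- Each `h i p q q` is related to `h i p p q`, which is `h (i + 1) p q q`; these steps lead from
`p` to `q`. -/
theorem IsHagemannMitschke.inverse (hh : IsHagemannMitschke k h) (hk : 1 ≤ k)
    (hRh : ∀ i, 1 ≤ i → i ≤ k → ∀ {a a' b b' c c'}, R a a' → R b b' → R c c' →
      R (h i a b c) (h i a' b' c')) (hR : ∀ a, R a a) {p q : B}
    (hpq : R q p) : ReflTransGen R p q := by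
  have key : ∀ i, 1 ≤ i → i ≤ k → ReflTransGen R p (h i p p q) := by
    intro i hi
    induction i, hi using Nat.le_induction with
    | base =>
      intro hik
      have := hRh 1 le_rfl hik (hR p) hpq (hR q)
      rw [hh.first] at this
      exact .single this
    | succ i hi ih =>
      intro hik
      have := hRh (i + 1) (by omega) hik (hR p) hpq (hR q)
      rw [← hh.step i hi (by omega)] at this
      exact (ih (by omega)).tail this
  have := key k hk le_rfl
  rwa [hh.last] at this

theorem IsHagemannMitschke.chain_trans (hh : IsHagemannMitschke k h) (hk : 1 ≤ k)
    (hRh : ∀ i, 1 ≤ i → i ≤ k → ∀ {a a' b b' c c'}, R a a' → R b b' → R c c' →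
      R (h i a b c) (h i a' b' c')) (hR : ∀ a, R a a) {p q s : B}
    (hpq : Chain R k p q) (hqs : ReflTransGen R q s) : Chain R k p s := by
  induction hqs with
  | refl => exact hpq
  | @tail s t _ hst ih =>
    refine hh.shorten hk hRh hR ?_
    obtain ⟨c, rfl, rfl, hc⟩ := ih
    refine ⟨fun i => if i ≤ k then c i else t, by simp, by simp, fun i hi => ?_⟩
    rcases Nat.lt_or_ge i k with h1 | h1
    · simpa [h1.le, Nat.succ_le_of_lt h1] using hc i h1
    · obtain rfl : i = k := by omega
      simpa using hst

theorem IsHagemannMitschke.chain_of_eqvGen (hh : IsHagemannMitschke k h) (hk : 1 ≤ k)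
    (hRh : ∀ i, 1 ≤ i → i ≤ k → ∀ {a a' b b' c c'}, R a a' → R b b' → R c c' →
      R (h i a b c) (h i a' b' c')) (hR : ∀ a, R a a) {p q : B}
    (hpq : EqvGen R p q) : Chain R k p q := by
  have key : ∀ {q q'}, EqvGen R q q' → ReflTransGen R q q' ∧ ReflTransGen R q' q := by
    intro q q' h
    induction h with
    | rel _ _ h => exact ⟨.single h, hh.inverse hk hRh hR h⟩
    | refl => exact ⟨.refl, .refl⟩
    | symm _ _ _ ih => exact ih.symm
    | trans _ _ _ _ _ ih₁ ih₂ => exact ⟨ih₁.1.trans ih₂.1, ih₂.2.trans ih₁.2⟩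
  exact hh.chain_trans hk hRh hR ⟨fun _ => p, rfl, rfl, fun _ _ => hR p⟩ (key hpq).1

end Chain

namespace Variety

variable {L : FirstOrder.Language.{u, v}} {V : Variety L}

/-! ### Hagemann–Mitschke terms and Pixley terms -/

section Pixley

variable [L.IsAlgebraic]

local notation "𝓍" => (Free.gen 0 : V.Free (Fin 2))
local notation "𝓏" => (Free.gen 1 : V.Free (Fin 2))

theorem Free.lift_lift {ι κ : Type} [Nonempty κ] {A : Type u} [L.Structure A] [Nonempty A]
    (hA : V.Mem A) (v : ι → V.Free κ) (w : κ → A) (p : V.Free ι) :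
    lift hA w (lift (Free.mem V κ) v p) = lift hA (fun i => lift hA w (v i)) p := by
  obtain ⟨t, rfl⟩ := mk_surjective p
  exact lift_realize hA w t v

/-- The map `σ i` cuts the generators after index `i`, so only `σ i` separates generators `i` and `i
+ 1`. Generators thus form a chain alternating between the meets of the odd and of the even kernels;
after permuting, the `i`-th link is respected by `σ i`. -/
theorem CongruencePermutable.exists_hagemannMitschke {k : ℕ} (hk : 1 ≤ k)
    (hV : V.CongruencePermutable (k + 1)) : ∃ h : ℕ → L.Term (Fin 3),
      ∀ (A : Type u) [L.Structure A] [Nonempty A], V.Mem A →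
        IsHagemannMitschke k fun i => termOp A (h i) := by
  have hF := Free.mem V (Fin 2)
  let σ : ℕ → ℕ → V.Free (Fin 2) := fun i j => if j ≤ i then 𝓍 else 𝓏
  let agree : Set ℕ → Congruence L (V.Free ℕ) := fun S => sInf ((fun i => Free.ker hF (σ i)) '' S)
  have agree_iff : ∀ S p q, (agree S).r p q ↔
      ∀ i ∈ S, Free.lift hF (σ i) p = Free.lift hF (σ i) q := fun S p q =>
    ⟨fun h i hi => h _ ⟨i, hi, rfl⟩, by rintro h _ ⟨i, hi, rfl⟩; exact h i hi⟩
  have hgen : ∀ S i, i ∉ S → (agree S).r (Free.gen i) (Free.gen (i + 1)) := by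
    intro S i hi
    refine (agree_iff _ _ _).2 fun j hj => ?_
    have hij : i ≠ j := fun h => hi (h ▸ hj)
    have : i ≤ j ↔ i + 1 ≤ j := by omega
    simp [σ, this]
  have h0 : altComp (k + 1) (agree {i | ¬ Even i}).r (agree {i | Even i}).r
      (Free.gen 0) (Free.gen (k + 1)) :=
    altComp_iff.2 ⟨Free.gen, rfl, rfl, fun i _ => ⟨fun h => hgen _ i (not_not.2 h),
      fun h => hgen _ i h⟩⟩
  rw [hV _ (Free.mem V ℕ)] at h0
  obtain ⟨c, hc0, hck, hc⟩ := altComp_iff.1 h0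
  choose q hq using fun i => Free.mk_surjective (c i)
  have hstep : ∀ i < k + 1, ∀ (A : Type u) [L.Structure A] [Nonempty A] (hA : V.Mem A) (a b : A),
      Free.lift hA (fun j => if j ≤ i then a else b) (c i) =
        Free.lift hA (fun j => if j ≤ i then a else b) (c (i + 1)) := by
    intro i hi A _ _ hA a b
    have h1 : Free.lift hF (σ i) (c i) = Free.lift hF (σ i) (c (i + 1)) := by
      by_cases he : Even i
      · exact (agree_iff _ _ _).1 ((hc i hi).1 he) i he
      · exact (agree_iff _ _ _).1 ((hc i hi).2 he) i he
    have h2 := congrArg (Free.lift hA ![a, b]) h1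
    rw [Free.lift_lift, Free.lift_lift] at h2
    have e : (fun j => Free.lift hA ![a, b] (σ i j)) = fun j => if j ≤ i then a else b := by
      funext j
      by_cases hj : j ≤ i <;> simp [σ, hj]
    rwa [e] at h2
  -- Setting `y = x` or `y = z` here gives the cut after `i` or the cut after `i - 1`, so
  -- consecutive terms meet at the same cut.
  let s : ℕ → ℕ → L.Term (Fin 3) := fun i j => if j < i then X₁ else if j = i then X₂ else X₃
  have hs : ∀ i, ∀ (A : Type u) [L.Structure A] [Nonempty A] (hA : V.Mem A) (a b d : A),
      termOp A ((q i).subst (s i)) a b d =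
        Free.lift hA (fun j => if j < i then a else if j = i then b else d) (c i) := by
    intro i A _ _ hA a b d
    rw [← hq, Free.lift_mk, termOp, Term.realize_subst]
    congr 1
    funext j
    by_cases h1 : j < i
    · simp only [s, h1, if_true]; rfl
    · by_cases h2 : j = i
      · simp only [s, h2, if_true, if_false, lt_irrefl]; rfl
      · simp only [s, h1, h2, if_false]; rfl
  have hleft : ∀ i, ∀ (A : Type u) [L.Structure A] [Nonempty A] (hA : V.Mem A) (a b : A),
      termOp A ((q i).subst (s i)) a a b = Free.lift hA (fun j => if j ≤ i then a else b) (c i) := by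
    intro i A _ _ hA a b
    rw [hs i A hA]
    congr 1
    funext j
    split_ifs <;> first | rfl | omega
  have hright : ∀ i, ∀ (A : Type u) [L.Structure A] [Nonempty A] (hA : V.Mem A) (a b : A),
      termOp A ((q (i + 1)).subst (s (i + 1))) a b b =
        Free.lift hA (fun j => if j ≤ i then a else b) (c (i + 1)) := by
    intro i A _ _ hA a b
    rw [hs (i + 1) A hA]
    congr 1
    funext j
    split_ifs <;> first | rfl | omega
  refine ⟨fun i => (q i).subst (s i), fun A _ _ hA => ⟨fun a b => ?_, fun a b => ?_,
    fun i _ hi a b => ?_⟩⟩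
  · rw [hright 0 A hA, ← hstep 0 (by omega) A hA, hc0]
    simp
  · rw [hleft k A hA, hstep k (by omega) A hA, hck]
    simp
  · rw [hleft i A hA, hstep i (by omega) A hA, hright i A hA]

theorem exists_pixley {k : ℕ} (hk : 1 ≤ k) (hD : V.CongruenceDistributive)
    (hP : V.CongruencePermutable (k + 1)) : ∃ P : ℕ → L.Term (Fin 3), V.Pixley k P := by
  have hF := Free.mem V (Fin 2)
  obtain ⟨h, hh⟩ := hP.exists_hagemannMitschke hk
  have hidem : ∀ i, 1 ≤ i → i ≤ k → V.IsIdempotent (h i) := fun i hi hik A _ _ hA a =>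
    (hh A hA).idem a i hi hik
  classical
  let g : ℕ → V.Bin → V.Bin → V.Bin → V.Bin := fun i =>
    if hi : 1 ≤ i ∧ i ≤ k then Bin.op (h i) (hidem i hi.1 hi.2) else fun a _ _ => a
  have hg : ∀ i (h1 : 1 ≤ i) (h2 : i ≤ k), g i = Bin.op (h i) (hidem i h1 h2) :=
    fun i h1 h2 => dif_pos ⟨h1, h2⟩
  have hHM : IsHagemannMitschke k g := by
    refine ⟨fun a b => ?_, fun a b => ?_, fun i h1 h2 a b => ?_⟩
    · rw [hg 1 le_rfl hk]
      exact Subtype.ext ((hh _ hF).first _ _)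
    · rw [hg k hk le_rfl]
      exact Subtype.ext ((hh _ hF).last _ _)
    · rw [hg i h1 h2.le, hg (i + 1) (by omega) h2]
      exact Subtype.ext ((hh _ hF).step i h1 h2 _ _)
  -- The edge relation is reversed because Pixley terms run from `t(x,z,z)` to `t(x,x,z)`. Only the
  -- fence is needed here, not its straightening.
  obtain ⟨c, hc0, hck, hc⟩ := hHM.chain_of_eqvGen (R := fun p q => Bin.Edge q p) hk
    (fun i h1 h2 _ _ _ _ _ _ ha hb hc => by
      rw [hg i h1 h2]
      exact Bin.Edge.op _ ha hb hc) Bin.Edge.refl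
    (eqvGen_map id (fun h => EqvGen.symm _ _ (EqvGen.rel _ _ h)) hD.eqvGen_x_z)
  have : ∀ i, ∃ t : L.Term (Fin 3), i < k → V.IsAbsorbing t ∧
      termOp _ t 𝓍 𝓍 𝓏 = (c (i + 1)).1 ∧ termOp _ t 𝓍 𝓏 𝓏 = (c i).1 := by
    intro i
    by_cases hi : i < k
    · obtain ⟨t, ht⟩ := hc i hi
      exact ⟨t, fun _ => ht⟩
    · exact ⟨X₁, fun h => absurd h hi⟩
  choose t ht using this
  refine ⟨fun i => t (i - 1), fun A _ _ hA => ⟨fun a b => ?_, fun a b => ?_,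
    fun i h1 h2 a b => ?_, fun i h1 h2 a b => ?_⟩⟩
  · refine Bin.lift_eq' (t := X₁) hA a b ((ht 0 hk).2.2.trans ?_)
    rw [hc0]; rfl
  · refine Bin.lift_eq (t := X₃) hA a b ((ht (k - 1) (by omega)).2.1.trans ?_)
    rw [show k - 1 + 1 = k by omega, hck]; rfl
  · exact (ht (i - 1) (by omega)).1 A hA a b
  · obtain ⟨j, rfl⟩ : ∃ j, i = j + 1 := ⟨i - 1, by omega⟩
    exact (Bin.lift_eq' hA a b ((ht (j + 1) h2).2.2.trans (ht j (by omega)).2.1.symm)).symm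

end Pixley

/-! ### Interpolating directed terms -/

/-- The terms `J_{2i+1} = D_i` and `J_{2i+2} = D_i(x, z, z)`, where `D_0` is taken to be `x`. -/
def interpolate (D : ℕ → L.Term (Fin 3)) : ℕ → L.Term (Fin 3)
  | 0 => X₁
  | j + 1 =>
    let t := if j / 2 = 0 then X₁ else D (j / 2)
    if j % 2 = 0 then t else comp t X₁ X₃ X₃

theorem interpolate_spec {A : Type w} [L.Structure A] {n : ℕ} (hn : 1 ≤ n)
    {D : ℕ → L.Term (Fin 3)} (first : ∀ x y : A, termOp A (D 1) x x y = x)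
    (middle : ∀ i, 1 ≤ i → i ≤ n → ∀ x y : A, termOp A (D i) x y x = x)
    (step : ∀ i, 1 ≤ i → i < n → ∀ x y : A, termOp A (D i) x y y = termOp A (D (i + 1)) x x y) :
    (∀ x y : A, termOp A (interpolate D 1) x x y = x) ∧
    (∀ i ≤ 2 * n + 1, ∀ x y : A, termOp A (interpolate D i) x y x = x) ∧
    (∀ i < n, ∀ x y : A, termOp A (interpolate D (2 * i + 1)) x y y =
      termOp A (interpolate D (2 * i + 2)) x y y) ∧
    (∀ i, 1 ≤ i → i ≤ n → ∀ x y : A, termOp A (interpolate D (2 * i)) x x y =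
      termOp A (interpolate D (2 * i + 1)) x x y) ∧
    (∀ i, 1 ≤ i → i < 2 * n + 1 → ∀ x y : A, termOp A (interpolate D i) x y y =
      termOp A (interpolate D (i + 1)) x x y) ∧
    interpolate D (2 * n + 1) = D n := by
  let E : ℕ → L.Term (Fin 3) := fun i => if i = 0 then X₁ else D i
  have hodd : ∀ i, interpolate D (2 * i + 1) = E i := fun i => by
    simp [interpolate, E]
  have heven : ∀ i, interpolate D (2 * i + 2) = comp (E i) X₁ X₃ X₃ := fun i => by
    simp [interpolate, E, show (2 * i + 1) / 2 = i by omega, show (2 * i + 1) % 2 = 1 by omega]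
  have hEmid : ∀ i ≤ n, ∀ x y : A, termOp A (E i) x y x = x := by
    intro i hi x y
    by_cases h : i = 0
    · simp [E, h]
    · simpa [E, h] using middle i (by omega) hi x y
  have hEstep : ∀ i < n, ∀ x y : A, termOp A (E i) x y y = termOp A (E (i + 1)) x x y := by
    intro i hi x y
    by_cases h : i = 0
    · simp [E, h, first]
    · simpa [E, h] using step i (by omega) hi x y
  refine ⟨fun x y => ?_, fun i hi x y => ?_, fun i hi x y => ?_, fun i h1 h2 x y => ?_,
    fun i h1 h2 x y => ?_, ?_⟩
  · rw [hodd 0]; rfl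
  · obtain ⟨j, rfl | rfl⟩ := Nat.even_or_odd' i
    · cases j with
      | zero => rfl
      | succ j =>
        rw [show 2 * (j + 1) = 2 * j + 2 by ring, heven]
        simpa using hEmid j (by omega) x x
    · rw [hodd]
      exact hEmid j (by omega) x y
  · rw [hodd, heven]
    simp
  · obtain ⟨j, rfl⟩ : ∃ j, i = j + 1 := ⟨i - 1, by omega⟩
    rw [hodd, show 2 * (j + 1) = 2 * j + 2 by ring, heven]
    simpa using hEstep j (by omega) x y
  · obtain ⟨j, rfl | rfl⟩ := Nat.even_or_odd' i
    · obtain ⟨l, rfl⟩ : ∃ l, j = l + 1 := ⟨j - 1, by omega⟩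
      rw [hodd, show 2 * (l + 1) = 2 * l + 2 by ring, heven]
      simpa using hEstep l (by omega) x y
    · rw [hodd, show 2 * j + 1 + 1 = 2 * j + 2 by ring, heven]
      simp
  · rw [hodd]
    simp [E, show n ≠ 0 by omega]

theorem DirectedJonsson.interpolate {n : ℕ} (hn : 1 ≤ n) {D : ℕ → L.Term (Fin 3)}
    (h : V.DirectedJonsson n D) :
    V.DirectedJonsson (2 * n + 1) (interpolate D) ∧ V.Jonsson n (interpolate D) := by
  constructor <;> intro A _ _ hA
  all_goals
    have h := h A hA
    obtain ⟨h1, h2, h3, h4, h5, h6⟩ := interpolate_spec hn h.first h.middle h.step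
    have last : ∀ x y : A, termOp A (Variety.interpolate D (2 * n + 1)) x y y = y := by
      rw [h6]; exact h.last
  · exact ⟨h1, last, fun i _ => h2 i, h5⟩
  · exact ⟨h1, last, h2, h3, h4⟩

theorem DirectedGumm.interpolate {n : ℕ} (hn : 1 ≤ n) {D : ℕ → L.Term (Fin 3)}
    {q : L.Term (Fin 3)} (h : V.DirectedGumm n D q) :
    V.Gumm n (interpolate D) q ∧ V.DirectedGumm (2 * n + 1) (interpolate D) q := by
  constructor <;> intro A _ _ hA
  all_goals
    have h := h A hA
    obtain ⟨h1, h2, h3, h4, h5, h6⟩ := interpolate_spec hn h.first h.middle h.step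
    have last : ∀ x y : A, termOp A (Variety.interpolate D (2 * n + 1)) x y y =
        termOp A q x y y := by
      rw [h6]; exact h.last
  · exact ⟨h1, last, h.maltsev, h2, h3, h4⟩
  · exact ⟨h1, last, h.maltsev, fun i _ => h2 i, h5⟩

variable [L.IsAlgebraic]

theorem CongruenceDistributive.exists_directedJonsson (hV : V.CongruenceDistributive) :
    ∃ n : ℕ, 1 ≤ n ∧ ∃ D : ℕ → L.Term (Fin 3), V.DirectedJonsson n D := by
  obtain ⟨n, hn, D, h1, h2, h3, h4⟩ := exists_directed (Bin.le_of_eqvGen hV.eqvGen_x_z)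
  refine ⟨n, hn, D, fun A _ _ hA => ⟨fun a b => ?_, fun a b => ?_, fun i _ _ => h1 i A hA,
    fun i hi hin a b => ?_⟩⟩
  · exact Bin.lift_eq (t := X₁) hA a b h2
  · exact Bin.lift_eq' (t := X₃) hA a b h3
  · exact Bin.lift_eq' hA a b (h4 i hi hin)

theorem CongruenceModular.exists_directedGumm (hV : V.CongruenceModular) :
    ∃ n : ℕ, 1 ≤ n ∧ ∃ (D : ℕ → L.Term (Fin 3)) (Q : L.Term (Fin 3)), V.DirectedGumm n D Q := by
  obtain ⟨p, q, hp, hq, hqp⟩ := hV.exists_climb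
  obtain ⟨n, hn, D, h1, h2, h3, h4⟩ := exists_directed hp
  refine ⟨n, hn, D, q, fun A _ _ hA => ⟨fun a b => ?_, fun a b => ?_, hq A hA,
    fun i _ _ => h1 i A hA, fun i hi hin a b => ?_⟩⟩
  · exact Bin.lift_eq (t := X₁) hA a b h2
  · simpa [Free.lift_termOp] using congrArg (Free.lift hA ![a, b]) (h3.trans hqp.symm)
  · exact Bin.lift_eq' hA a b (h4 i hi hin)

end Variety

end UnivAlg

theorem theorem1p1 {L : FirstOrder.Language.{u, v}} [L.IsAlgebraic]
    (V : UnivAlg.Variety L) :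
    ((V.CongruenceDistributive ↔
        ∃ n : ℕ, 1 ≤ n ∧ ∃ D : ℕ → L.Term (Fin 3), V.DirectedJonsson n D) ∧
      (V.CongruenceDistributive →
        ∃ n : ℕ, 1 ≤ n ∧ ∃ J : ℕ → L.Term (Fin 3),
          V.DirectedJonsson (2 * n + 1) J ∧ V.Jonsson n J)) ∧
    (∀ k : ℕ, 1 ≤ k →
      ((V.CongruenceDistributive ∧ V.CongruencePermutable (k + 1)) ↔
        ∃ P : ℕ → L.Term (Fin 3), V.Pixley k P)) ∧
    ((V.CongruenceModular ↔
        ∃ n : ℕ, 1 ≤ n ∧ ∃ (D : ℕ → L.Term (Fin 3)) (Q : L.Term (Fin 3)),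
          V.DirectedGumm n D Q) ∧
      (V.CongruenceModular →
        ∃ n : ℕ, 1 ≤ n ∧ ∃ (J : ℕ → L.Term (Fin 3)) (P : L.Term (Fin 3)),
          V.Gumm n J P ∧ V.DirectedGumm (2 * n + 1) J P)) := by
  refine ⟨⟨⟨fun h => h.exists_directedJonsson, ?_⟩, fun h => ?_⟩, fun k hk => ⟨fun h =>
    UnivAlg.Variety.exists_pixley hk h.1 h.2, ?_⟩, ⟨fun h => h.exists_directedGumm, ?_⟩,
    fun h => ?_⟩
  · rintro ⟨n, hn, D, h⟩ A _ _ hA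
    exact (h A hA).distributive hn
  · obtain ⟨n, hn, D, hD⟩ := h.exists_directedJonsson
    exact ⟨n, hn, _, hD.interpolate hn⟩
  · rintro ⟨P, h⟩
    refine ⟨fun A _ _ hA => (h A hA).distributive hk, fun A _ _ hA α β => ?_⟩
    funext a b
    exact propext ⟨(h A hA).altComp hk, (h A hA).altComp hk⟩
  · rintro ⟨n, hn, D, Q, h⟩ A _ _ hA
    exact (h A hA).modular hn
  · obtain ⟨n, hn, D, Q, hD⟩ := h.exists_directedGumm
    exact ⟨n, hn, _, Q, hD.interpolate hn⟩
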